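/- Let $q$ be a prime power, let $n\ge 2$ and $r$ be integers with $\gcd(n,r)=1$ and $\lceil n/2\rceil\le r\le n-1$, and assume that $q$ is odd if $n=2$. Put $T_n(z)=z+z^q+\dots+z^{q^{n-1}}$, let $f_r(x)\in\mathbb F_{q^n}[x]$ be the remainder of $T_n(x^{1+q^r})$ on division by $x^{q^n}-x$, and let $\mathcal X_{n,r}$ be the plane curve $T_n(y)=f_r(x)$ over $\mathbb F_{q^n}$. Then $T_n(y)-f_r(x)$ is irreducible over $\mathbb F_{q^n}$, and exactly one place $P_\infty$ of the function field $F=\mathbb F_{q^n}(x,y)$ of $\mathcal X_{n,r}$ (equivalently, one closed point of the nonsingular projective model) lies over the point $(0:1:0)$ of the projective closure. Its Weierstrass semigroup $H(P_\infty)=\{m\in\mathbb N_0 : \exists f\in F\setminus\{0\},\ \mathrm{div}_\infty(f)=mP_\infty\}$ is $$H(P_\infty)=\langle q^{n-1},\ q^{n-1}+q^{r-1},\ q^n+q^{n-r},\ q^{2r-1}+q^{n-r-1},\ q^{2r}-q^n+q^r+1\rangle .$$ Moreover, $H(P_\infty)$ is telescopic, i.e. it is generated by some sequence $(a_1,\dots,a_m)$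 of positive integers with $\gcd(a_1,\dots,a_m)=1$ such that, with $d_i=\gcd(a_1,\dots,a_i)$, the integer $a_i/d_i$ lies in the semigroup generated by $a_1/d_{i-1},\dots,a_{i-1}/d_{i-1}$ for $i=2,\dots,m$. In particular it is symmetric, i.e. the set $\mathbb N_0\setminus H(P_\infty)$ is finite and, if $g$ is its number of elements, its largest element is $2g-1$. -/

import Mathlib

open Polynomial
open scoped WithZero

noncomputable section

namespace Xnr

/-- The polynomial `T_n = X + X^q + ⋯ + X^(q^(n-1))` over a commutative ring `R`. -/
def tracePoly (R : Type*) [CommRing R] (q n : ℕ) : R[X] :=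
  ∑ i ∈ Finset.range n, X ^ q ^ i

/-- The polynomial `f_r = T_n(x^(1+q^r)) mod (x^(q^n) - x)`. -/
def fPoly (K : Type*) [Field K] (q n r : ℕ) : K[X] :=
  (tracePoly K q n).comp (X ^ (1 + q ^ r)) % (X ^ q ^ n - X)

/-- The polynomial `T_n(y) - f_r(x)`, an element of `K[x][y]`. -/
def curvePoly (K : Type*) [Field K] (q n r : ℕ) : K[X][X] :=
  tracePoly K[X] q n - C (fPoly K q n r)

/-- The affine coordinate ring `K[x, y] / (T_n(y) - f_r(x))`. -/
abbrev CoordinateRing (K : Type*) [Field K] (q n r : ℕ) : Type _ :=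
  AdjoinRoot (curvePoly K q n r)

/-- The function field `K(x, y)`: the fraction ring of the coordinate ring
(a field as soon as the coordinate ring is a domain). -/
abbrev FunctionField (K : Type*) [Field K] (q n r : ℕ) : Type _ :=
  FractionRing (CoordinateRing K q n r)

/-- The coordinate function `x`. -/
def xFun (K : Type*) [Field K] (q n r : ℕ) : FunctionField K q n r :=
  algebraMap (CoordinateRing K q n r) _ (AdjoinRoot.of (curvePoly K q n r) X)

/-- The coordinate function `y`. -/
def yFun (K : Type*) [Field K] (q n r : ℕ) : FunctionField K q n r :=
  algebraMap (CoordinateRing K q n r) _ (AdjoinRoot.root (curvePoly K q n r))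

/-- A place of `F / K`, i.e. a point of the nonsingular projective model, given by its normalized
discrete valuation, which is trivial on `K`. It is written multiplicatively: `v f = exp (-ord f)`. -/
@[ext]
structure Place (K F : Type*) [Field K] [Field F] [Algebra K F] where
  v : Valuation F ℤᵐ⁰
  trivial_on_const : ∀ a : K, a ≠ 0 → v (algebraMap K F a) = 1
  normalized : Function.Surjective v

namespace Place

variable {K F : Type*} [Field K] [Field F] [Algebra K F]

/-- The order `v_P(f)` of a function `f ≠ 0` at the place `P`. -/
def ord (P : Place K F) (f : F) : ℤ := -WithZero.log (P.v f)

/-- The coefficient of `P` in the pole divisor of `f ≠ 0`, namely `max (-v_P(f)) 0`. -/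
def poleOrder (P : Place K F) (f : F) : ℕ := (-P.ord f).toNat

/-- `H(P)`: the `m` for which some function `f ≠ 0` has pole divisor `m P`. -/
def weierstrassSemigroup (P : Place K F) : Set ℕ :=
  {m | ∃ f : F, f ≠ 0 ∧ P.poleOrder f = m ∧ ∀ Q : Place K F, Q ≠ P → Q.poleOrder f = 0}

end Place

/-- The place `P` lies over the point `(0 : 1 : 0)` of the projective closure of the plane curve:
the local coordinates `x / y` and `1 / y` at `(0 : 1 : 0)` vanish at `P`. -/
def LiesOverInfty (K : Type*) [Field K] (q n r : ℕ) [IsDomain (CoordinateRing K q n r)]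
    (P : Place K (FunctionField K q n r)) : Prop :=
  P.v (xFun K q n r) < P.v (yFun K q n r) ∧ 1 < P.v (yFun K q n r)

/-- `d_i = gcd(a_1, …, a_i)` (with indices starting from `0`). -/
def prefixGcd {m : ℕ} (a : Fin m → ℕ) (i : Fin m) : ℕ := (Finset.Iic i).gcd a

/-- Telescopic sequences of positive integers: the gcd is `1`, and for every `j` that has a
predecessor `i`, `a_j / d_j` lies in the semigroup generated by the `a_k / d_i`, `k ≤ i`. -/
structure IsTelescopicSeq {m : ℕ} (a : Fin m → ℕ) : Prop where
  pos : ∀ i, 0 < a i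
  gcd_eq_one : Finset.univ.gcd a = 1
  mem : ∀ i j : Fin m, (i : ℕ) + 1 = j →
    a j / prefixGcd a j ∈ AddSubmonoid.closure {b | ∃ k ≤ i, b = a k / prefixGcd a i}

/-- A semigroup is telescopic if it is generated by a telescopic sequence. -/
def IsTelescopic (S : Set ℕ) : Prop :=
  ∃ (m : ℕ) (a : Fin m → ℕ), IsTelescopicSeq a ∧
    S = (AddSubmonoid.closure (Set.range a) : Set ℕ)

/-- A semigroup with `g` gaps is symmetric if `g` is finite and the largest gap is `2 g - 1`. -/
def IsSymmetric (S : Set ℕ) : Prop :=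
  Sᶜ.Finite ∧ ∃ l : ℕ, IsGreatest Sᶜ l ∧ l + 1 = 2 * Sᶜ.ncard

end Xnr

end

/-! Write `N = q^(n-1)`, `m = n - r`, `F` for the `q`-power Frobenius and `b` for the last of the
five generators. Applying `F - 1` to the equation of the curve gives `F^n y - y = (F^n x - x)(F^r x
+ F^m x)` (`frob_sub_self_eq`). So, up to the low-order term `y`, `F^n` turns `y` into a polynomial
in `x`, and pole orders of polynomials in `x` and `y` can be read off after applying `F^n`. For `m <
r` the functions `uFun`, `wFun`, `zFun` are built so that successive leading terms cancel there;
with `x` and `y` they realize the five generators.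

Total ramification. The number `b` is prime to `q`, and at any place where `x` has a pole, `|z|^N =
|x|^b`. Hence `N` divides the ramification index, which is at most the degree over `K(x)`, which is
at most `N`. So equality holds throughout (`Place.totallyRamified`). Applied to any irreducible
factor of the curve polynomial over `K(x)`, this proves irreducibility. The powers of `z` below `N`
are then a basis with values distinct modulo `N`, so the place is unique.

No further elements. The semigroup `S` of the five generators is obtained by repeated gluing, hence
is telescopic and symmetric, with largest gap `l = q^(n+r-1) - q^r - 1`. A larger semigroup would
contain `l` (`IsSymmetricAbout.eq_of_le`), so it suffices to exclude `l`. The conjugates of `z` come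
from the translations `y ↦ y + α` with `α` of trace zero; their differences give the value of
`M'(z)`, `M` being the minimal polynomial of `z`. If `f` had its only pole at infinity, of order
`l`, its trace would be a polynomial in `x`. But by Euler's dual basis the trace is the coefficient
of `z^(N-1)` in `f M'(z)`, and the pole order of this product makes that coefficient have degree
`-1` (`Place.valuation_trace`).

If `m = r`, coprimality forces `n = 2` and `r = 1`; then `y` plays the role of `z` and the semigroup
is `⟨q, q + 1⟩`. -/

namespace Xnr

/-! ### Symmetric numerical semigroups and gluing. -/

/-- `S`, seen as a set of integers, is exchanged with its complement by `z ↦ l - z`. -/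
def IsSymmetricAbout (S : AddSubmonoid ℕ) (l : ℤ) : Prop :=
  ∀ z : ℤ, (∃ s ∈ S, (s : ℤ) = z) ↔ ¬ ∃ s ∈ S, (s : ℤ) = l - z

lemma isSymmetricAbout_top : IsSymmetricAbout ⊤ (-1) := by
  intro z
  constructor
  · rintro ⟨s, -, rfl⟩ ⟨t, -, ht⟩
    omega
  · intro h
    refine ⟨z.toNat, trivial, ?_⟩
    by_contra hz
    exact h ⟨(-1 - z).toNat, trivial, by omega⟩

lemma mem_map_mul_sup_closure {S : AddSubmonoid ℕ} {d a z : ℕ} :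
    z ∈ S.map (AddMonoidHom.mulLeft d) ⊔ AddSubmonoid.closure {a} ↔
      ∃ s ∈ S, ∃ j : ℕ, z = d * s + j * a := by
  rw [AddSubmonoid.mem_sup]
  constructor
  · rintro ⟨_, ⟨s, hs, rfl⟩, y, hy, rfl⟩
    obtain ⟨j, rfl⟩ := AddSubmonoid.mem_closure_singleton.1 hy
    exact ⟨s, hs, j, by simp⟩
  · rintro ⟨s, hs, j, rfl⟩
    exact ⟨d * s, ⟨s, hs, rfl⟩, j * a, AddSubmonoid.mem_closure_singleton.2 ⟨j, by simp⟩, rfl⟩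

/-- Gluing a symmetric semigroup `S` with a multiple of some `a ∈ S`. -/
lemma IsSymmetricAbout.glue {S : AddSubmonoid ℕ} {l : ℤ} (hS : IsSymmetricAbout S l) {d a : ℕ}
    (hd : 0 < d) (ha : a ∈ S) (hda : Nat.Coprime d a) :
    IsSymmetricAbout (S.map (AddMonoidHom.mulLeft d) ⊔ AddSubmonoid.closure {a})
      (d * l + (d - 1) * a) := by
  -- Every integer is uniquely `d * w + i * a` with `0 ≤ i < d`. Since `a ∈ S`, surplus multiples of
  -- `d * a` can be absorbed into `w`, so membership depends on `w` alone. The reflection acts by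
  -- `(w, i) ↦ (l - w, d - 1 - i)`.
  have key : ∀ (w : ℤ) (i : ℕ), i < d →
      ((∃ s ∈ S.map (AddMonoidHom.mulLeft d) ⊔ AddSubmonoid.closure {a}, (s : ℤ) = d * w + i * a)
        ↔ ∃ s ∈ S, (s : ℤ) = w) := by
    intro w i hi
    constructor
    · rintro ⟨t, ht, htw⟩
      obtain ⟨s, hs, j, rfl⟩ := mem_map_mul_sup_closure.1 ht
      push_cast at htw
      have h1 : (d : ℤ) ∣ ((j : ℤ) - i) * a := ⟨w - s, by linear_combination htw⟩
      have h2 : (d : ℤ) ∣ (j : ℤ) - i :=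
        (Nat.isCoprime_iff_coprime.2 hda).dvd_of_dvd_mul_right h1
      obtain ⟨k, hk⟩ := h2
      have hk0 : 0 ≤ k := by
        by_contra hneg
        have : k ≤ -1 := by omega
        have : (d : ℤ) * k ≤ d * (-1) := by gcongr
        omega
      lift k to ℕ using hk0
      refine ⟨s + k * a, S.add_mem hs ?_, ?_⟩
      · simpa using S.nsmul_mem ha k
      · have hd' : (d : ℤ) ≠ 0 := by positivity
        apply mul_left_cancel₀ hd'
        push_cast
        linear_combination htw - a * hk
    · rintro ⟨s, hs, rfl⟩
      exact ⟨d * s + i * a, mem_map_mul_sup_closure.2 ⟨s, hs, i, rfl⟩, by push_cast; ring⟩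
  intro z
  obtain ⟨u, v, huv⟩ := Nat.isCoprime_iff_coprime.2 hda
  have hd' : (0 : ℤ) < d := by exact_mod_cast hd
  obtain ⟨i, hi⟩ : ∃ i : ℕ, (i : ℤ) = (z * v) % d :=
    ⟨((z * v) % d).toNat, Int.toNat_of_nonneg (Int.emod_nonneg _ hd'.ne')⟩
  have hid : i < d := by
    have := Int.emod_lt_of_pos (z * v) hd'
    omega
  have hz : z = d * (z * u + (z * v) / d * a) + i * a := by
    have := Int.emod_add_mul_ediv (z * v) d
    rw [hi]
    linear_combination (-z) * huv - a * this
  generalize z * u + (z * v) / d * a = w at hz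
  have hz' : (d * l + (d - 1) * a : ℤ) - z = d * (l - w) + ((d - 1 - i : ℕ) : ℤ) * a := by
    rw [hz, Nat.sub_sub, Nat.cast_sub (by omega)]
    push_cast
    ring
  rw [hz', hz, key w i hid, key (l - w) _ (by omega)]
  exact hS w

lemma IsSymmetricAbout.glue_closure {T : Set ℕ} {l : ℤ}
    (hS : IsSymmetricAbout (AddSubmonoid.closure T) l) {d a : ℕ}
    (hd : 0 < d) (ha : a ∈ AddSubmonoid.closure T) (hda : Nat.Coprime d a) :
    IsSymmetricAbout (AddSubmonoid.closure (insert a ((d * ·) '' T))) (d * l + (d - 1) * a) := by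
  have := hS.glue hd ha hda
  rwa [AddMonoidHom.map_mclosure, ← AddSubmonoid.closure_union, Set.union_singleton] at this

lemma IsSymmetricAbout.isSymmetric {S : AddSubmonoid ℕ} {l : ℕ} (hS : IsSymmetricAbout S l) :
    IsSymmetric (S : Set ℕ) := by
  have hsym : ∀ z : ℕ, z ≤ l → (z ∈ S ↔ l - z ∉ S) := by
    intro z hz
    have h := hS z
    have h1 : (∃ s ∈ S, (s : ℤ) = z) ↔ z ∈ S :=
      ⟨fun ⟨s, hs, h⟩ ↦ by rwa [← Nat.cast_injective h], fun h ↦ ⟨z, h, rfl⟩⟩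
    have h2 : (∃ s ∈ S, (s : ℤ) = l - z) ↔ l - z ∈ S :=
      ⟨fun ⟨s, hs, h⟩ ↦ by rwa [show l - z = s by omega], fun h ↦ ⟨l - z, h, by omega⟩⟩
    rwa [h1, h2] at h
  have hbig : ∀ z : ℕ, l < z → z ∈ S := by
    intro z hz
    obtain ⟨s, hs, h⟩ := (hS z).2 (by rintro ⟨s, hs, h⟩; omega)
    rwa [← Nat.cast_injective h]
  have hle : ∀ z ∈ (S : Set ℕ)ᶜ, z ≤ l := fun z hz ↦ by
    by_contra h
    exact hz (hbig z (by omega))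
  classical
  have hfin : (S : Set ℕ)ᶜ = ((Finset.range (l + 1)).filter (· ∉ S) : Finset ℕ) := by
    ext z
    simp only [Set.mem_compl_iff, SetLike.mem_coe, Finset.coe_filter, Finset.mem_range,
      Set.mem_ofPred_eq]
    exact ⟨fun h ↦ ⟨Nat.lt_succ_of_le (hle z h), h⟩, fun h ↦ h.2⟩
  refine ⟨hfin ▸ Finset.finite_toSet _, l, ⟨?_, hle⟩, ?_⟩
  · have := (hsym 0 (Nat.zero_le _)).1 S.zero_mem
    simpa using this
  · rw [hfin, Set.ncard_coe_finset]
    have h1 := Finset.card_filter_add_card_filter_not (s := Finset.range (l + 1)) (· ∈ S)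
    have h2 : ((Finset.range (l + 1)).filter (· ∈ S)).card =
        ((Finset.range (l + 1)).filter (· ∉ S)).card := by
      refine Finset.card_bij' (fun z _ ↦ l - z) (fun z _ ↦ l - z) ?_ ?_ ?_ ?_ <;>
        simp only [Finset.mem_filter, Finset.mem_range]
      · exact fun z hz ↦ ⟨by omega, (hsym z (by omega)).1 hz.2⟩
      · intro z hz
        refine ⟨by omega, (hsym _ (by omega)).2 ?_⟩
        rw [Nat.sub_sub_self (by omega)]
        exact hz.2
      · intro z hz; omega
      · intro z hz; omega
    rw [Finset.card_range] at h1
    omega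

/-- A semigroup containing a symmetric one but not its largest gap equals it. -/
lemma IsSymmetricAbout.eq_of_le {S : AddSubmonoid ℕ} {l : ℕ} (hS : IsSymmetricAbout S l)
    {H : Set ℕ} (hSH : (S : Set ℕ) ⊆ H) (hadd : ∀ a ∈ H, ∀ b ∈ H, a + b ∈ H) (hl : l ∉ H) :
    H = S := by
  refine Set.Subset.antisymm (fun h hh ↦ ?_) hSH
  by_contra hhS
  have : ¬ ∃ s ∈ S, (s : ℤ) = h := fun ⟨s, hs, e⟩ ↦ hhS (by rwa [← Nat.cast_injective e])
  rw [hS, not_not] at this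
  obtain ⟨s, hs, e⟩ := this
  exact hl (by rw [show l = h + s by omega]; exact hadd h hh s (hSH hs))

lemma coprime_pow_mul_add_one (q j t : ℕ) : Nat.Coprime (q ^ j) (q * t + 1) := by
  apply Nat.Coprime.pow_left
  simp

lemma coprime_pow_pow_add_one (q j : ℕ) {k : ℕ} (hk : 0 < k) : Nat.Coprime (q ^ j) (q ^ k + 1) := by
  obtain ⟨k, rfl⟩ := Nat.exists_eq_succ_of_ne_zero hk.ne'
  rw [pow_succ']
  exact coprime_pow_mul_add_one _ _ _

lemma add_mul_mem_closure {T : Set ℕ} {a b : ℕ} (ha : a ∈ T) (hb : b ∈ T) (k : ℕ) :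
    a + k * b ∈ AddSubmonoid.closure T :=
  add_mem (AddSubmonoid.subset_closure ha) (by
    simpa using nsmul_mem (AddSubmonoid.subset_closure hb) k)

section Generators

variable (q μ σ : ℕ)

/-- The generators, with `n - r = μ + 1` and `2 * r - n = σ + 1`. -/
def gens : Fin 5 → ℕ :=
  ![q ^ (2 * μ + σ + 2), q ^ (2 * μ + σ + 2) + q ^ (μ + σ + 1), q ^ (2 * μ + σ + 3) + q ^ (μ + 1),
    q ^ (2 * μ + 2 * σ + 3) + q ^ μ,
    q ^ (2 * μ + 2 * σ + 4) - q ^ (2 * μ + σ + 3) + q ^ (μ + σ + 2) + 1]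

variable {q}

/-- The first summand is the fourth generator divided by `q ^ μ`, and `q ^ (μ + σ + 2)` is the first
generator divided by `q ^ μ`: this is the last telescopic condition. -/
lemma gens_four (hq : 1 ≤ q) : gens q μ σ 4 =
    (q ^ (μ + 2 * σ + 3) + 1) + ((q ^ (μ + 1) - 1) * (q ^ (σ + 1) - 1)) * q ^ (μ + σ + 2) := by
  obtain ⟨A, hA⟩ := Nat.exists_eq_add_of_le' (Nat.one_le_pow (μ + 1) q hq)
  obtain ⟨B, hB⟩ := Nat.exists_eq_add_of_le' (Nat.one_le_pow (σ + 1) q hq)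
  have h1 : q ^ (2 * μ + 2 * σ + 4) = q ^ (2 * μ + σ + 3) + q ^ (2 * μ + σ + 3) * B := by
    rw [show 2 * μ + 2 * σ + 4 = (2 * μ + σ + 3) + (σ + 1) by ring, pow_add, hB]; ring
  have h2 : q ^ (2 * μ + σ + 3) = q ^ (μ + σ + 2) * (A + 1) := by rw [← hA, ← pow_add]; ring_nf
  have h3 : q ^ (μ + 2 * σ + 3) = q ^ (μ + σ + 2) * (B + 1) := by rw [← hB, ← pow_add]; ring_nf
  change q ^ (2 * μ + 2 * σ + 4) - q ^ (2 * μ + σ + 3) + q ^ (μ + σ + 2) + 1 = _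
  rw [h1, Nat.add_sub_cancel_left, h2, h3, hA, hB]
  simp only [Nat.add_sub_cancel]
  ring

lemma gens_one : gens q μ σ 1 = q ^ (μ + σ + 1) * (q ^ (μ + 1) + 1) := by
  simp only [gens, Matrix.cons_val]; ring

lemma gens_two : gens q μ σ 2 = q ^ (μ + 1) * (q ^ (μ + σ + 2) + 1) := by
  simp only [gens, Matrix.cons_val]; ring

lemma gens_three : gens q μ σ 3 = q ^ μ * (q ^ (μ + 2 * σ + 3) + 1) := by
  simp only [gens, Matrix.cons_val]; ring

lemma coprime_gens_four (hq : 1 ≤ q) (j : ℕ) : Nat.Coprime (q ^ j) (gens q μ σ 4) := by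
  have h : gens q μ σ 4 = q * (q ^ (μ + 2 * σ + 2) +
      ((q ^ (μ + 1) - 1) * (q ^ (σ + 1) - 1)) * q ^ (μ + σ + 1)) + 1 := by
    rw [gens_four μ σ hq]
    ring
  rw [h]
  exact coprime_pow_mul_add_one _ _ _

/-- This and the next two memberships serve twice: as the hypothesis `a ∈ S` of the gluing steps and
as the telescopic conditions. -/
lemma quotient_two_mem (hq : 1 ≤ q) : q ^ (μ + σ + 2) + 1 ∈
    AddSubmonoid.closure {q ^ (μ + 1) + 1, q ^ (μ + 1)} := by
  have h : q ^ (μ + σ + 2) + 1 = (q ^ (μ + 1) + 1) + (q ^ (σ + 1) - 1) * q ^ (μ + 1) := by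
    obtain ⟨B, hB⟩ := Nat.exists_eq_add_of_le' (Nat.one_le_pow (σ + 1) q hq)
    rw [show μ + σ + 2 = (σ + 1) + (μ + 1) by ring, pow_add, hB]
    simp only [Nat.add_sub_cancel]
    ring
  rw [h]
  exact add_mul_mem_closure (by simp) (by simp) _

lemma quotient_three_mem (hq : 1 ≤ q) : q ^ (μ + 2 * σ + 3) + 1 ∈
    AddSubmonoid.closure
      {q ^ (μ + σ + 2) + 1, q ^ σ * (q ^ (μ + 1) + 1), q ^ σ * q ^ (μ + 1)} := by
  have h : q ^ (μ + 2 * σ + 3) + 1 =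
      (q ^ (μ + σ + 2) + 1) + (q * (q ^ (σ + 1) - 1)) * (q ^ σ * q ^ (μ + 1)) := by
    obtain ⟨B, hB⟩ := Nat.exists_eq_add_of_le' (Nat.one_le_pow (σ + 1) q hq)
    rw [show μ + 2 * σ + 3 = (σ + 1) + (μ + σ + 2) by ring, pow_add, hB]
    simp only [Nat.add_sub_cancel]
    ring
  rw [h]
  exact add_mul_mem_closure (by simp) (by simp) _

lemma quotient_four_mem (hq : 1 ≤ q) : gens q μ σ 4 ∈
    AddSubmonoid.closure {q ^ (μ + 2 * σ + 3) + 1, q * (q ^ (μ + σ + 2) + 1),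
      q * (q ^ σ * (q ^ (μ + 1) + 1)), q * (q ^ σ * q ^ (μ + 1))} := by
  rw [gens_four μ σ hq, show q ^ (μ + σ + 2) = q * (q ^ σ * q ^ (μ + 1)) by ring]
  exact add_mul_mem_closure (by simp) (by simp) _

/-- Four gluings starting from `⊤`, with `d = q ^ (μ + 1)`, `q ^ σ`, `q`, `q ^ μ`, the ratios of
consecutive prefix gcds of the generators. -/
lemma isSymmetricAbout_gens (hq : 1 ≤ q) :
    IsSymmetricAbout (AddSubmonoid.closure (Set.range (gens q μ σ)))
      ((q : ℤ) ^ (3 * μ + 2 * σ + 4) - q ^ (μ + σ + 2) - 1) := by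
  have hpos : ∀ j, 0 < q ^ j := fun j ↦ Nat.pow_pos hq
  have h1 : IsSymmetricAbout (AddSubmonoid.closure ({1} : Set ℕ)) (-1) := by
    rw [show AddSubmonoid.closure ({1} : Set ℕ) = ⊤ from Nat.addSubmonoidClosure_one]
    exact isSymmetricAbout_top
  have h2 := h1.glue_closure (hpos (μ + 1)) (a := q ^ (μ + 1) + 1)
    (AddSubmonoid.mem_closure_singleton.2 ⟨q ^ (μ + 1) + 1, by simp⟩)
    (coprime_pow_pow_add_one _ _ (Nat.succ_pos _))
  rw [Set.image_singleton, mul_one] at h2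
  have h3 := h2.glue_closure (hpos σ) (quotient_two_mem μ σ hq)
    (coprime_pow_pow_add_one _ _ (by omega))
  rw [Set.image_pair] at h3
  have h4 := h3.glue_closure hq (quotient_three_mem μ σ hq)
    (by simpa using coprime_pow_pow_add_one q 1 (k := μ + 2 * σ + 3) (by omega))
  rw [Set.image_insert_eq, Set.image_pair] at h4
  have h5 := h4.glue_closure (hpos μ) (quotient_four_mem μ σ hq) (coprime_gens_four μ σ hq μ)
  simp only [Set.image_insert_eq, Set.image_singleton] at h5
  convert h5 using 1
  · congr 1
    have h0 : gens q μ σ 0 = q ^ μ * (q * (q ^ σ * q ^ (μ + 1))) := by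
      simp only [gens, Matrix.cons_val]; ring
    have h1 : gens q μ σ 1 = q ^ μ * (q * (q ^ σ * (q ^ (μ + 1) + 1))) := by
      rw [gens_one]; ring
    have h2 : gens q μ σ 2 = q ^ μ * (q * (q ^ (μ + σ + 2) + 1)) := by
      rw [gens_two]; ring
    rw [← h0, ← h1, ← h2, ← gens_three]
    ext z
    simp only [Set.mem_range, Fin.exists_fin_succ, Set.mem_insert_iff, Set.mem_singleton_iff]
    simp only [IsEmpty.exists_iff, or_false, Fin.succ_zero_eq_one, Fin.succ_one_eq_two]
    rw [show Fin.succ (2 : Fin 4) = 3 from rfl,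
      show (Fin.succ (2 : Fin 3)).succ = (4 : Fin 5) from rfl]
    tauto
  · rw [gens_four μ σ hq]
    have hA := Nat.one_le_pow (μ + 1) q hq
    have hB := Nat.one_le_pow (σ + 1) q hq
    push_cast [Nat.cast_sub hA, Nat.cast_sub hB]
    ring

lemma isTelescopicSeq_gens (hq : 1 ≤ q) : IsTelescopicSeq (gens q μ σ) := by
  have hpos : ∀ j, 0 < q ^ j := fun j ↦ Nat.pow_pos hq
  have d0 : prefixGcd (gens q μ σ) 0 = q ^ (2 * μ + σ + 2) := by
    rw [prefixGcd, show Finset.Iic (0 : Fin 5) = {0} by decide, Finset.gcd_singleton]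
    simp [gens]
  have d1 : prefixGcd (gens q μ σ) 1 = q ^ (μ + σ + 1) := by
    rw [prefixGcd, show Finset.Iic (1 : Fin 5) = insert 1 (Finset.Iic 0) by decide,
      Finset.gcd_insert, ← prefixGcd, d0, gens_one,
      show 2 * μ + σ + 2 = (μ + σ + 1) + (μ + 1) by ring, pow_add q (μ + σ + 1)]
    change Nat.gcd _ _ = _
    rw [Nat.gcd_mul_left, Nat.gcd_comm, coprime_pow_pow_add_one _ _ (Nat.succ_pos _), mul_one]
  have d2 : prefixGcd (gens q μ σ) 2 = q ^ (μ + 1) := by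
    rw [prefixGcd, show Finset.Iic (2 : Fin 5) = insert 2 (Finset.Iic 1) by decide,
      Finset.gcd_insert, ← prefixGcd, d1, gens_two,
      show μ + σ + 1 = (μ + 1) + σ by ring, pow_add q (μ + 1) σ]
    change Nat.gcd _ _ = _
    rw [Nat.gcd_mul_left, Nat.gcd_comm, coprime_pow_pow_add_one _ _ (by omega), mul_one]
  have d3 : prefixGcd (gens q μ σ) 3 = q ^ μ := by
    rw [prefixGcd, show Finset.Iic (3 : Fin 5) = insert 3 (Finset.Iic 2) by decide,
      Finset.gcd_insert, ← prefixGcd, d2, gens_three, pow_add q μ 1]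
    change Nat.gcd _ _ = _
    rw [Nat.gcd_mul_left, Nat.gcd_comm, coprime_pow_pow_add_one _ _ (by omega), mul_one]
  have d4 : prefixGcd (gens q μ σ) 4 = 1 := by
    rw [prefixGcd, show Finset.Iic (4 : Fin 5) = insert 4 (Finset.Iic 3) by decide,
      Finset.gcd_insert, ← prefixGcd, d3]
    change Nat.gcd _ _ = _
    rw [Nat.gcd_comm, coprime_gens_four μ σ hq]
  refine ⟨?_, ?_, ?_⟩
  · intro i
    fin_cases i <;> simp [gens, hpos]
  · rw [show (Finset.univ : Finset (Fin 5)) = Finset.Iic 4 by decide]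
    exact d4
  · have q00 : gens q μ σ 0 / q ^ (2 * μ + σ + 2) = 1 := by
      simp [gens, Nat.div_self (hpos _)]
    have q01 : gens q μ σ 0 / q ^ (μ + σ + 1) = q ^ (μ + 1) :=
      Nat.div_eq_of_eq_mul_right (hpos _) (by simp only [gens, Matrix.cons_val]; ring)
    have q02 : gens q μ σ 0 / q ^ (μ + 1) = q ^ σ * q ^ (μ + 1) :=
      Nat.div_eq_of_eq_mul_right (hpos _) (by simp only [gens, Matrix.cons_val]; ring)
    have q03 : gens q μ σ 0 / q ^ μ = q * (q ^ σ * q ^ (μ + 1)) :=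
      Nat.div_eq_of_eq_mul_right (hpos _) (by simp only [gens, Matrix.cons_val]; ring)
    have q11 : gens q μ σ 1 / q ^ (μ + σ + 1) = q ^ (μ + 1) + 1 :=
      Nat.div_eq_of_eq_mul_right (hpos _) (gens_one μ σ)
    have q12 : gens q μ σ 1 / q ^ (μ + 1) = q ^ σ * (q ^ (μ + 1) + 1) :=
      Nat.div_eq_of_eq_mul_right (hpos _) (by rw [gens_one]; ring)
    have q22 : gens q μ σ 2 / q ^ (μ + 1) = q ^ (μ + σ + 2) + 1 :=
      Nat.div_eq_of_eq_mul_right (hpos _) (gens_two μ σ)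
    have q33 : gens q μ σ 3 / q ^ μ = q ^ (μ + 2 * σ + 3) + 1 :=
      Nat.div_eq_of_eq_mul_right (hpos _) (gens_three μ σ)
    have q13 : gens q μ σ 1 / q ^ μ = q * (q ^ σ * (q ^ (μ + 1) + 1)) :=
      Nat.div_eq_of_eq_mul_right (hpos _) (by rw [gens_one]; ring)
    have q23 : gens q μ σ 2 / q ^ μ = q * (q ^ (μ + σ + 2) + 1) :=
      Nat.div_eq_of_eq_mul_right (hpos _) (by rw [gens_two]; ring)
    intro i j hij
    obtain ⟨rfl, rfl⟩ | ⟨rfl, rfl⟩ | ⟨rfl, rfl⟩ | ⟨rfl, rfl⟩ : (i = 0 ∧ j = 1) ∨ (i = 1 ∧ j = 2) ∨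
        (i = 2 ∧ j = 3) ∨ (i = 3 ∧ j = 4) := by
      simp only [Fin.ext_iff, Fin.val_zero, Fin.val_one, Fin.val_two]
      change _ ∨ _ ∨ (_ ∧ _ = 3) ∨ (_ = 3 ∧ _ = 4)
      omega
    · rw [d1, q11, d0]
      have : 1 ∈ AddSubmonoid.closure
          {b | ∃ k ≤ (0 : Fin 5), b = gens q μ σ k / q ^ (2 * μ + σ + 2)} :=
        AddSubmonoid.subset_closure ⟨0, le_rfl, q00.symm⟩
      simpa using nsmul_mem this (q ^ (μ + 1) + 1)
    · rw [d2, q22, d1]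
      refine AddSubmonoid.closure_mono ?_ (quotient_two_mem μ σ hq)
      rintro z (rfl | rfl)
      · exact ⟨1, by decide, q11.symm⟩
      · exact ⟨0, by decide, q01.symm⟩
    · rw [d3, q33, d2]
      refine AddSubmonoid.closure_mono ?_ (quotient_three_mem μ σ hq)
      rintro z (rfl | rfl | rfl)
      · exact ⟨2, by decide, q22.symm⟩
      · exact ⟨1, by decide, q12.symm⟩
      · exact ⟨0, by decide, q02.symm⟩
    · rw [d4, Nat.div_one, d3]
      refine AddSubmonoid.closure_mono ?_ (quotient_four_mem μ σ hq)
      rintro z (rfl | rfl | rfl | rfl)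
      · exact ⟨3, by decide, q33.symm⟩
      · exact ⟨2, by decide, q23.symm⟩
      · exact ⟨1, by decide, q13.symm⟩
      · exact ⟨0, by decide, q03.symm⟩

lemma range_gens : Set.range (gens q μ σ) =
    {q ^ (2 * μ + σ + 2), q ^ (2 * μ + σ + 2) + q ^ (μ + σ + 1), q ^ (2 * μ + σ + 3) + q ^ (μ + 1),
    q ^ (2 * μ + 2 * σ + 3) + q ^ μ,
    q ^ (2 * μ + 2 * σ + 4) - q ^ (2 * μ + σ + 3) + q ^ (μ + σ + 2) + 1} := by
  simp only [gens, Matrix.range_cons, Matrix.range_empty, Set.union_empty]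
  ext z
  simp only [Set.mem_union, Set.mem_insert_iff, Set.mem_singleton_iff]

end Generators

/-- The case `n = 2`, `r = 1`, where the other three generators are redundant. -/
lemma isSymmetricAbout_self_succ {q : ℕ} (hq : 1 ≤ q) :
    IsSymmetricAbout (AddSubmonoid.closure {q, q + 1}) ((q : ℤ) ^ 2 - q - 1) := by
  have h1 : IsSymmetricAbout (AddSubmonoid.closure ({1} : Set ℕ)) (-1) := by
    rw [show AddSubmonoid.closure ({1} : Set ℕ) = ⊤ from Nat.addSubmonoidClosure_one]
    exact isSymmetricAbout_top
  have h2 := h1.glue_closure hq (a := q + 1)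
    (AddSubmonoid.mem_closure_singleton.2 ⟨q + 1, by simp⟩) (by simp)
  rw [Set.image_singleton, mul_one, Set.pair_comm] at h2
  convert h2 using 1
  push_cast
  ring

lemma isTelescopicSeq_self_succ {q : ℕ} (hq : 1 ≤ q) : IsTelescopicSeq ![q, q + 1] := by
  have d0 : prefixGcd ![q, q + 1] 0 = q := by
    rw [prefixGcd, show Finset.Iic (0 : Fin 2) = {0} by decide, Finset.gcd_singleton]
    simp
  have d1 : prefixGcd ![q, q + 1] 1 = 1 := by
    rw [prefixGcd, show Finset.Iic (1 : Fin 2) = insert 1 (Finset.Iic 0) by decide,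
      Finset.gcd_insert, ← prefixGcd, d0]
    change Nat.gcd (q + 1) q = 1
    simp
  refine ⟨?_, ?_, ?_⟩
  · intro i
    fin_cases i
    · exact hq
    · exact Nat.succ_pos q
  · rw [show (Finset.univ : Finset (Fin 2)) = Finset.Iic 1 by decide]
    exact d1
  · intro i j hij
    obtain ⟨rfl, rfl⟩ : i = 0 ∧ j = 1 := by
      simp only [Fin.ext_iff, Fin.val_zero, Fin.val_one]
      omega
    rw [d0, d1]
    have : 1 ∈ AddSubmonoid.closure {b | ∃ k ≤ (0 : Fin 2), b = ![q, q + 1] k / q} :=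
      AddSubmonoid.subset_closure ⟨0, le_rfl, by simp [Nat.div_self hq]⟩
    simpa using nsmul_mem this (q + 1)

/-! ### Valuations and places at infinity of extensions of `K(X)`. -/

section SumOfDistinctValues

variable {L Γ : Type*} [Field L] [LinearOrderedCommGroupWithZero Γ]

/-- A finite sum of elements whose nonzero values are distinct has the largest of these values. -/
lemma valuation_sum_eq_sup (v : Valuation L Γ) {ι : Type*} (s : Finset ι) (f : ι → L)
    (hf : ∀ i ∈ s, ∀ j ∈ s, i ≠ j → f i ≠ 0 → v (f i) ≠ v (f j)) :
    v (∑ i ∈ s, f i) = s.sup (fun i ↦ v (f i)) := by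
  classical
  rcases s.eq_empty_or_nonempty with rfl | hs
  · rw [Finset.sum_empty, map_zero, Finset.sup_empty]
    exact le_antisymm zero_le bot_le
  obtain ⟨j, hj, hmax⟩ := s.exists_max_image (fun i ↦ v (f i)) hs
  have hsup : s.sup (fun i ↦ v (f i)) = v (f j) :=
    le_antisymm (Finset.sup_le hmax) (Finset.le_sup (f := fun i ↦ v (f i)) hj)
  rw [hsup]
  by_cases h0 : f j = 0
  · have : ∀ i ∈ s, f i = 0 := fun i hi ↦ by
      have := hmax i hi
      rw [h0, map_zero, le_zero_iff, Valuation.zero_iff] at this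
      exact this
    rw [Finset.sum_eq_zero this, h0]
  · refine v.map_sum_eq_of_lt hj ?_
    intro i hi
    rw [Finset.mem_sdiff, Finset.mem_singleton] at hi
    exact lt_of_le_of_ne (hmax i hi.1) (Ne.symm (hf j hj i hi.1 (Ne.symm hi.2) h0))

end SumOfDistinctValues

section Infinity

variable {K L : Type*} [Field K] [Field L] [Algebra K L] [Algebra (RatFunc K) L]
  [IsScalarTower K (RatFunc K) L]

/-- The image of the variable in an extension of `K(X)`. -/
noncomputable abbrev ratX (K L : Type*) [Field K] [Field L] [Algebra (RatFunc K) L] : L :=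
  algebraMap (RatFunc K) L RatFunc.X

lemma Place.valuation_algebraMap (P : Place K L) (hP : 1 < P.v (ratX K L)) {c : RatFunc K}
    (hc : c ≠ 0) : P.v (algebraMap (RatFunc K) L c) = P.v (ratX K L) ^ c.intDegree := by
  let w := P.v.comap (algebraMap (RatFunc K) L)
  have : w.IsTrivialOn K := ⟨fun a ha ↦ by
    change P.v (algebraMap (RatFunc K) L (algebraMap K _ a)) = 1
    rw [← IsScalarTower.algebraMap_apply]
    exact P.trivial_on_const a ha⟩
  exact RatFunc.valuation_eq_valuation_X_zpow_intDegree_of_one_lt_valuation_X (v := w) hP hc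

/-- The integral closure in `L` of the valuation ring at infinity is Dedekind; a prime above the
maximal ideal contains `1 / X`, so `X` has a pole at its adic valuation. -/
lemma exists_place_one_lt (K L : Type*) [Field K] [Field L] [Algebra K L] [Algebra (RatFunc K) L]
    [IsScalarTower K (RatFunc K) L] [FiniteDimensional (RatFunc K) L]
    [Algebra.IsSeparable (RatFunc K) L] :
    ∃ P : Place K L, 1 < P.v (ratX K L) := by
  classical
  let w := RatFunc.inftyValuation K
  let R := w.valuationSubring
  have : IsCyclic (ℤᵐ⁰)ˣ :=
    isCyclic_of_surjective (WithZero.unitsWithZeroEquiv (α := Multiplicative ℤ)).symm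
    (MulEquiv.surjective _)
  have : Nontrivial (MonoidWithZeroHom.valueGroup (.ofClass w)) := by
    infer_instance
  have : IsDiscreteValuationRing R := inferInstance
  have : IsDedekindDomain (integralClosure R L) :=
    integralClosure.isDedekindDomain R (RatFunc K) L
  have : IsFractionRing (integralClosure R L) L :=
    integralClosure.isFractionRing_of_finite_extension (RatFunc K) L
  set B := integralClosure R L
  have hX : w RatFunc.X⁻¹ < 1 := by
    rw [map_inv₀, RatFunc.inftyValuation.X, ← WithZero.exp_neg, ← WithZero.exp_zero,
      WithZero.exp_lt_exp]
    norm_num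
  let t : R := ⟨RatFunc.X⁻¹, hX.le⟩
  have ht : ¬ IsUnit t := by
    intro h
    have := (Valuation.integer.integers w).one_of_isUnit h
    exact hX.ne this
  obtain ⟨M, hM, hMt⟩ := Ideal.exists_ideal_over_maximal_of_isIntegral (S := B)
    (IsLocalRing.maximalIdeal R) (by
      rw [(RingHom.injective_iff_ker_eq_bot _).1 (FaithfulSMul.algebraMap_injective R B)]
      exact bot_le)
  have htM : algebraMap R B t ∈ M := by
    rw [← Ideal.mem_comap, hMt]
    exact ht
  have ht0 : algebraMap R L t ≠ 0 := by
    change algebraMap (RatFunc K) L RatFunc.X⁻¹ ≠ 0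
    simp [RatFunc.X_ne_zero]
  have hM0 : M ≠ ⊥ := by
    rintro rfl
    have : algebraMap R B t = 0 := htM
    apply ht0
    rw [IsScalarTower.algebraMap_apply R B L, this, map_zero]
  let u : IsDedekindDomain.HeightOneSpectrum B := ⟨M, hM.isPrime, hM0⟩
  refine ⟨⟨u.valuation L, fun a ha ↦ ?_, u.valuation_surjective L⟩, ?_⟩
  · have hmem : ∀ a : K, IsIntegral R (algebraMap K L a) := fun a ↦ by
      have ha : w (algebraMap K (RatFunc K) a) ≤ 1 := by
        by_cases h : a = 0
        · simp [h]
        · exact (RatFunc.inftyValuation.C K h).le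
      have : algebraMap K L a = algebraMap R L ⟨algebraMap K (RatFunc K) a, ha⟩ :=
        IsScalarTower.algebraMap_apply K (RatFunc K) L a
      rw [this]
      exact isIntegral_algebraMap
    have hle : ∀ a : K, u.valuation L (algebraMap K L a) ≤ 1 := fun a ↦
      u.valuation_le_one (K := L) (⟨algebraMap K L a, hmem a⟩ : B)
    refine le_antisymm (hle a) ?_
    have := hle a⁻¹
    rw [map_inv₀, map_inv₀] at this
    exact (inv_le_one₀ (by simpa [zero_lt_iff] using ha)).1 this
  · have h1 : u.valuation L (algebraMap B L (algebraMap R B t)) < 1 :=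
      (u.valuation_lt_one_iff_mem (K := L) _).2 htM
    rw [← IsScalarTower.algebraMap_apply] at h1
    have h2 : algebraMap R L t = (ratX K L)⁻¹ := map_inv₀ (algebraMap (RatFunc K) L) RatFunc.X
    rw [h2] at h1
    exact (Valuation.one_lt_val_iff _ (by simp [RatFunc.X_ne_zero])).2 h1

end Infinity

/-! ### Ramification, power bases and traces. -/

section Ramification

open WithZero

variable {K L : Type*} [Field K] [Field L] [Algebra K L] [Algebra (RatFunc K) L]
  [IsScalarTower K (RatFunc K) L]

lemma Place.valuation_smul (P : Place K L) {a : ℤ} (ha : 0 < a) (hx : P.v (ratX K L) = exp a)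
    {c : RatFunc K} (hc : c ≠ 0) {w : L} {d : ℤ} (hw : P.v w = exp d) :
    P.v (c • w) = exp (c.intDegree * a + d) := by
  have h1 : 1 < P.v (ratX K L) := by rwa [hx, ← exp_zero, exp_lt_exp]
  rw [Algebra.smul_def, map_mul, P.valuation_algebraMap h1 hc, hx, hw, ← exp_zsmul, ← exp_add,
    smul_eq_mul]

section Family

variable (P : Place K L) {a : ℤ} (ha : 0 < a) (hx : P.v (ratX K L) = exp a)
  {ι : Type*} [Fintype ι] {w : ι → L} {d : ι → ℤ} (hw : ∀ i, P.v (w i) = exp (d i))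
  (hd : ∀ i j, i ≠ j → ¬ a ∣ d i - d j)

-- Coefficients in `K(X)` change values only by multiples of `a`, so nonzero terms with incongruent
-- `d i` cannot tie.
include ha hx hw hd in
lemma Place.valuation_sum_smul (c : ι → RatFunc K) :
    P.v (∑ i, c i • w i) = Finset.univ.sup fun i ↦ P.v (c i • w i) := by
  refine valuation_sum_eq_sup _ _ _ fun i _ j _ hij hi h ↦ ?_
  have hci : c i ≠ 0 := fun h ↦ hi (by rw [h, zero_smul])
  have hcj : c j ≠ 0 := by
    intro h'
    rw [h', zero_smul, map_zero, Valuation.zero_iff] at h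
    exact hi h
  rw [P.valuation_smul ha hx hci (hw i), P.valuation_smul ha hx hcj (hw j), exp_inj] at h
  exact hd i j hij ⟨(c j).intDegree - (c i).intDegree, by linear_combination h⟩

include ha hx hw hd in
lemma Place.linearIndependent : LinearIndependent (RatFunc K) w := by
  rw [Fintype.linearIndependent_iff]
  intro c hc i
  have h := P.valuation_sum_smul ha hx hw hd c
  rw [hc, map_zero] at h
  have h' : P.v (c i • w i) ≤ 0 := by
    rw [h]
    exact Finset.le_sup (f := fun i ↦ P.v (c i • w i)) (Finset.mem_univ i)
  by_contra hci
  rw [P.valuation_smul ha hx hci (hw i)] at h'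
  exact absurd h' (by simp)

end Family

/-- The ramification index is at most the degree. -/
lemma Place.le_finrank [FiniteDimensional (RatFunc K) L] (P : Place K L) {a : ℕ} (ha : 0 < a)
    (hx : P.v (ratX K L) = exp (a : ℤ)) : a ≤ Module.finrank (RatFunc K) L := by
  obtain ⟨t, ht⟩ := P.normalized (exp 1)
  -- Powers of a function with a simple pole: the exponents below `a` are incongruent modulo `a`.
  have := P.linearIndependent (a := a) (by exact_mod_cast ha) hx (ι := Fin a)
    (w := fun i ↦ t ^ (i : ℕ)) (d := fun i ↦ (i : ℕ)) (fun i ↦ by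
      rw [map_pow, ht, ← exp_nsmul]; simp) (by
      intro i j hij h
      apply hij
      ext
      have := Int.eq_zero_of_abs_lt_dvd h (by rw [abs_lt]; omega)
      omega)
  simpa using this.fintype_card_le_finrank

lemma not_dvd_mul_sub {N b : ℕ} (hb : Nat.Coprime N b) (i j : Fin N) (hij : i ≠ j) :
    ¬ (N : ℤ) ∣ ((i : ℕ) * b : ℤ) - (j : ℕ) * b := by
  rw [← sub_mul]
  intro h
  have := (Nat.isCoprime_iff_coprime.2 hb).dvd_of_dvd_mul_right h
  apply hij
  ext
  have := Int.eq_zero_of_abs_lt_dvd this (by rw [abs_lt]; omega)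
  omega

section TotallyRamified

variable {N b : ℕ} (hN : 0 < N) (hb : Nat.Coprime N b) {z : L}

omit [Algebra (RatFunc K) L] [IsScalarTower K (RatFunc K) L] in
lemma Place.valuation_pow (P : Place K L) {b : ℕ} (hz : P.v z = exp (b : ℤ)) (i : ℕ) :
    P.v (z ^ i) = exp (i * b : ℤ) := by
  rw [map_pow, hz, ← exp_nsmul, nsmul_eq_mul]

include hN hb in
lemma Place.linearIndependent_pow (P : Place K L) (hx : P.v (ratX K L) = exp (N : ℤ))
    (hz : P.v z = exp (b : ℤ)) :
    LinearIndependent (RatFunc K) (fun i : Fin N ↦ z ^ (i : ℕ)) :=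
  P.linearIndependent (by exact_mod_cast hN) hx (fun i ↦ P.valuation_pow hz i)
    (not_dvd_mul_sub hb)

include hN hb in
lemma Place.natDegree_minpoly [FiniteDimensional (RatFunc K) L] (P : Place K L)
    (hx : P.v (ratX K L) = exp (N : ℤ)) (hz : P.v z = exp (b : ℤ))
    (hfin : Module.finrank (RatFunc K) L = N) : (minpoly (RatFunc K) z).natDegree = N := by
  refine le_antisymm (hfin ▸ minpoly.natDegree_le z) ?_
  by_contra! hlt
  have hli := P.linearIndependent_pow hN hb hx hz
  rw [Fintype.linearIndependent_iff] at hli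
  have h0 := hli (fun i ↦ (minpoly (RatFunc K) z).coeff i) (by
    rw [Fin.sum_univ_eq_sum_range (fun i ↦ (minpoly (RatFunc K) z).coeff i • z ^ i),
      ← aeval_eq_sum_range' hlt, minpoly.aeval]) ⟨_, hlt⟩
  have := (minpoly.monic (Algebra.IsIntegral.isIntegral (R := RatFunc K) z)).coeff_natDegree
  exact one_ne_zero (this.symm.trans h0)

include hN hb in
/-- The power basis given by a function whose value is prime to the ramification index. -/
lemma Place.exists_powerBasis [FiniteDimensional (RatFunc K) L] (P : Place K L)
    (hx : P.v (ratX K L) = exp (N : ℤ)) (hz : P.v z = exp (b : ℤ))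
    (hfin : Module.finrank (RatFunc K) L = N) :
    ∃ pb : PowerBasis (RatFunc K) L, pb.gen = z := by
  have hdeg := P.natDegree_minpoly hN hb hx hz hfin
  have htop := (Field.primitive_element_iff_minpoly_natDegree_eq (RatFunc K) z).2
    (hdeg.trans hfin.symm)
  have hz' := Algebra.IsIntegral.isIntegral (R := RatFunc K) z
  refine ⟨(IntermediateField.adjoin.powerBasis hz').map
    ((IntermediateField.equivOfEq htop).trans IntermediateField.topEquiv), ?_⟩
  simp

-- Both valuations are given by the same maximum formula in the basis of powers of `z`.
include hN hb in
lemma Place.eq_of_valuation_eq [FiniteDimensional (RatFunc K) L] (P Q : Place K L)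
    (hPx : P.v (ratX K L) = exp (N : ℤ)) (hPz : P.v z = exp (b : ℤ))
    (hQx : Q.v (ratX K L) = exp (N : ℤ)) (hQz : Q.v z = exp (b : ℤ))
    (hfin : Module.finrank (RatFunc K) L = N) : P = Q := by
  have hN' : (0 : ℤ) < N := by exact_mod_cast hN
  ext f
  have hne : Nonempty (Fin N) := ⟨⟨0, hN⟩⟩
  let B := basisOfLinearIndependentOfCardEqFinrank (P.linearIndependent_pow hN hb hPx hPz)
    (by simp [hfin])
  have hf : f = ∑ i, B.repr f i • z ^ (i : ℕ) := by
    conv_lhs => rw [← B.sum_repr f]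
    simp [B]
  rw [hf, P.valuation_sum_smul hN' hPx (fun i : Fin N ↦ P.valuation_pow hPz i) (not_dvd_mul_sub hb),
    Q.valuation_sum_smul hN' hQx (fun i : Fin N ↦ Q.valuation_pow hQz i) (not_dvd_mul_sub hb)]
  congr 1
  funext i
  by_cases h : B.repr f i = 0
  · rw [h, zero_smul, map_zero, map_zero]
  · rw [P.valuation_smul hN' hPx h (P.valuation_pow hPz i),
      Q.valuation_smul hN' hQx h (Q.valuation_pow hQz i)]

include hN hb in
/-- If `δ` is the value of the different of `z`, then a function of pole order
`(N - 1) b - δ - N` has a trace with a simple zero at infinity. -/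
lemma Place.valuation_trace [FiniteDimensional (RatFunc K) L] [Algebra.IsSeparable (RatFunc K) L]
    (P : Place K L) (hx : P.v (ratX K L) = exp (N : ℤ)) (hz : P.v z = exp (b : ℤ))
    (hfin : Module.finrank (RatFunc K) L = N) {δ : ℤ}
    (hδ : P.v (aeval z (derivative (minpoly (RatFunc K) z))) = exp δ) {f : L}
    (hf : P.v f = exp ((N - 1) * b - δ - N)) :
    Algebra.trace (RatFunc K) L f ≠ 0 ∧ (Algebra.trace (RatFunc K) L f).intDegree = -1 := by
  have hN' : (0 : ℤ) < N := by exact_mod_cast hN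
  obtain ⟨pb, rfl⟩ := P.exists_powerBasis hN hb hx hz hfin
  obtain rfl : pb.dim = N := by rw [← pb.finrank, hfin]
  set D := aeval pb.gen (derivative (minpoly (RatFunc K) pb.gen)) with hD
  have hD0 : D ≠ 0 := by
    rw [← Valuation.ne_zero_iff P.v, hδ]
    exact exp_ne_zero
  let last : Fin pb.dim := ⟨pb.dim - 1, by omega⟩
  have hintegral := Algebra.IsIntegral.isIntegral (R := RatFunc K) pb.gen
  -- Euler: the dual basis consists of the coefficients of `M(T) / (T - z)` divided by `M'(z)`, and
  -- this quotient polynomial is monic.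
  have hlast : pb.basis.traceDual last = D⁻¹ := by
    have hdeg := natDegree_minpolyDiv_succ hintegral
    rw [P.natDegree_minpoly hN hb hx hz hfin] at hdeg
    have hmon := minpolyDiv_monic hintegral
    rw [Module.Basis.traceDual_powerBasis_eq]
    rw [Monic, leadingCoeff, show (minpolyDiv (RatFunc K) pb.gen).natDegree = pb.dim - 1 by omega]
      at hmon
    rw [hmon, one_div]
  have htr : pb.basis.repr (f * D) last = Algebra.trace (RatFunc K) L f := by
    rw [← pb.basis.traceDual_traceDual, Module.Basis.traceDual_repr_apply, hlast,
      Algebra.traceForm_apply, mul_inv_cancel_right₀ hD0]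
  have hsum : f * D = ∑ i, pb.basis.repr (f * D) i • pb.gen ^ (i : ℕ) := by
    conv_lhs => rw [← pb.basis.sum_repr (f * D)]
    simp
  have hv := P.valuation_sum_smul hN' hx (fun i : Fin pb.dim ↦ P.valuation_pow hz i)
    (not_dvd_mul_sub hb) (fun i ↦ pb.basis.repr (f * D) i)
  rw [← hsum, map_mul, hf, hδ, ← exp_add] at hv
  have hne : (Finset.univ : Finset (Fin pb.dim)).Nonempty := ⟨last, Finset.mem_univ _⟩
  obtain ⟨i, -, hi⟩ := Finset.exists_mem_eq_sup _ hne
    (fun i : Fin pb.dim ↦ P.v (pb.basis.repr (f * D) i • pb.gen ^ (i : ℕ)))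
  rw [hi] at hv
  have hc : pb.basis.repr (f * D) i ≠ 0 := by
    intro h
    rw [h, zero_smul, map_zero] at hv
    exact exp_ne_zero hv
  rw [P.valuation_smul hN' hx hc (P.valuation_pow hz i), exp_inj] at hv
  -- The value of `f * D` is `(N - 1) b - N`, congruent to `(N - 1) b` modulo `N`: only the term
  -- with `z ^ (N - 1)` can attain it, and then with a coefficient of degree `-1`.
  have hil : i = last := by
    by_contra hil
    refine not_dvd_mul_sub hb i last hil ⟨-1 - (pb.basis.repr (f * D) i).intDegree, ?_⟩
    have : ((last : ℕ) : ℤ) = pb.dim - 1 := by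
      simp only [last]
      omega
    rw [this]
    linear_combination -hv
  rw [hil, htr] at hc hv
  refine ⟨hc, ?_⟩
  have : ((last : ℕ) : ℤ) = pb.dim - 1 := by
    simp only [last]
    omega
  rw [this] at hv
  apply mul_right_cancel₀ hN'.ne'
  linear_combination -hv

end TotallyRamified

section Integral

variable [Algebra K[X] L] [IsScalarTower K[X] (RatFunc K) L] [FiniteDimensional (RatFunc K) L]
  [Algebra.IsSeparable (RatFunc K) L]

omit [IsScalarTower K (RatFunc K) L] in
/-- A function which is regular wherever `X` is regular is integral over `K[X]`. -/
lemma isIntegral_of_forall_place [IsScalarTower K K[X] L] {f : L}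
    (hf : ∀ Q : Place K L, Q.v (ratX K L) ≤ 1 → Q.v f ≤ 1) : IsIntegral K[X] f := by
  set B := integralClosure K[X] L
  have : IsDedekindDomain B := integralClosure.isDedekindDomain K[X] (RatFunc K) L
  have : IsFractionRing B L :=
    integralClosure.isFractionRing_of_finite_extension (RatFunc K) L
  -- Each prime of the integral closure gives a place where `X` is regular, and the closure is the
  -- intersection of the corresponding valuation rings.
  have key : ∀ u : IsDedekindDomain.HeightOneSpectrum B, u.valuation L f ≤ 1 := by
    intro u
    have hle : ∀ p : K[X], u.valuation L (algebraMap K[X] L p) ≤ 1 := fun p ↦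
      u.valuation_le_one (K := L) (⟨algebraMap K[X] L p, isIntegral_algebraMap⟩ : B)
    have hleK : ∀ a : K, u.valuation L (algebraMap K L a) ≤ 1 := fun a ↦ by
      rw [IsScalarTower.algebraMap_apply K K[X] L]
      exact hle _
    refine hf ⟨u.valuation L, fun a ha ↦ ?_, u.valuation_surjective L⟩ ?_
    · refine le_antisymm (hleK a) ?_
      have := hleK a⁻¹
      rw [map_inv₀, map_inv₀] at this
      exact (inv_le_one₀ (by simpa [zero_lt_iff] using ha)).1 this
    · have := hle X
      rwa [IsScalarTower.algebraMap_apply K[X] (RatFunc K) L, RatFunc.algebraMap_X] at this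
  obtain ⟨g, hg⟩ := IsDedekindDomain.HeightOneSpectrum.mem_integers_of_valuation_le_one L f key
  rw [← hg]
  exact g.2

-- The trace lies in `K[X]`; a vanishing trace is covered because `intDegree` of `0` is `0`.
omit [Algebra K L] [IsScalarTower K (RatFunc K) L] [Algebra.IsSeparable (RatFunc K) L] in
lemma zero_le_intDegree_trace {f : L} (hf : IsIntegral K[X] f) :
    0 ≤ (Algebra.trace (RatFunc K) L f).intDegree := by
  obtain ⟨p, hp⟩ := IsIntegrallyClosed.isIntegral_iff.1
    (Algebra.isIntegral_trace (L := RatFunc K) hf)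
  rw [← hp, RatFunc.intDegree_polynomial]
  positivity

end Integral

end Ramification

/-! ### Frobenius powers and the functions `u`, `w`, `z`. -/

section Frobenius

/-- The ring endomorphism `a ↦ a ^ q ^ i`, where `q = p ^ k`. -/
noncomputable def frob {B : Type*} [CommRing B] (p k : ℕ) [ExpChar B p] (i : ℕ) : B →+* B :=
  iterateFrobenius B p (k * i)

variable {B : Type*} [CommRing B] (p k : ℕ) [ExpChar B p]

lemma frob_apply (i : ℕ) (a : B) : frob p k i a = a ^ (p ^ k) ^ i := by
  rw [frob, iterateFrobenius_def, pow_mul]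

lemma frob_frob (i j : ℕ) (a : B) : frob p k i (frob p k j a) = frob p k (i + j) a := by
  simp only [frob_apply, ← pow_mul, ← pow_add]
  ring_nf

lemma frob_zero (a : B) : frob p k 0 a = a := by simp [frob_apply]

lemma frob_comm (i j : ℕ) (a : B) :
    frob p k i (frob p k j a) = frob p k j (frob p k i a) := by
  rw [frob_frob, frob_frob, add_comm]

lemma frob_one_frob (i : ℕ) (a : B) : frob p k 1 (frob p k i a) = frob p k (i + 1) a := by
  rw [frob_frob, add_comm]

end Frobenius

section Functions

variable {B : Type*} [CommRing B] (p k : ℕ) [ExpChar B p] (n r m s t : ℕ)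

/-- `x ^ q ^ m (x ^ q ^ n - x)`. -/
noncomputable def hFun (x : B) : B := frob p k m x * (frob p k n x - x)

/-- The function `u` with `u ^ q ^ n - u = h - h ^ q`. -/
noncomputable def uFun (x y : B) : B :=
  ∑ i ∈ Finset.range s, frob p k (r * i) (y - frob p k r x * x) +
    ∑ i ∈ Finset.range t, frob p k (1 + n * i) (hFun p k n m x)

/-- The monomial `x ^ (q ^ (r - m) - 1)`. -/
def monom (x : B) : B := x ^ ((p ^ k) ^ (r - m) - 1)

/-- The function with pole order `q ^ (2 * r - 1) + q ^ (m - 1)`. -/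
noncomputable def wFun (x y : B) : B :=
  frob p k r y - frob p k r x * frob p k (r - m) x - frob p k r x * x + y * monom p k r m x

/-- The function with pole order `q ^ (2 * r) - q ^ n + q ^ r + 1`. -/
noncomputable def zFun (x y : B) : B :=
  frob p k 1 (wFun p k r m x y) + frob p k 1 (monom p k r m x) * uFun p k n r m s t x y -
    monom p k r m x ^ (p ^ k - 1) * wFun p k r m x y

variable {n r m s t} {x y : B}

lemma monom_mul_self (hp : 0 < p) : monom p k r m x * x = frob p k (r - m) x := by
  have : 0 < (p ^ k) ^ (r - m) := by positivity
  rw [monom, frob_apply, ← pow_succ, Nat.sub_add_cancel this]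

lemma monom_pow_mul_self (hp : 0 < p) :
    monom p k r m x ^ (p ^ k - 1) * monom p k r m x = frob p k 1 (monom p k r m x) := by
  have : 0 < p ^ k := by positivity
  rw [frob_apply, ← pow_succ, Nat.sub_add_cancel this, pow_one]

section Equation

variable (hn : n = r + m)
  (hE : frob p k n y - y = (frob p k n x - x) * (frob p k r x + frob p k m x))

-- With `y' = y - x^(q^r + 1)` one has `F^n y' - y' = h - F^r h`. Summing over powers of `F^r`
-- telescopes to `h - F^(r s) h`, and since `r s = 1 + n t` the second sum in `u` replaces `F^(r s)
-- h` by `F h`.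
include hn hE in
lemma frob_uFun (hst : r * s = 1 + n * t) :
    frob p k n (uFun p k n r m s t x y) - uFun p k n r m s t x y =
      hFun p k n m x - frob p k 1 (hFun p k n m x) := by
  set h := hFun p k n m x with hh
  set y' := y - frob p k r x * x with hy'
  have h1 : frob p k n y' - y' = h - frob p k r h := by
    have e1 : frob p k r (frob p k m x) = frob p k n x := by rw [frob_frob, hn]
    rw [hy', hh, hFun]
    simp only [map_sub, map_mul, frob_comm p k n r x, e1]
    linear_combination hE
  have h2 : ∑ i ∈ Finset.range s, frob p k (r * i) (frob p k n y' - y') =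
      h - frob p k (r * s) h := by
    rw [h1]
    have := Finset.sum_range_sub' (fun i ↦ frob p k (r * i) h) s
    rw [mul_zero, frob_zero] at this
    rw [← this]
    refine Finset.sum_congr rfl fun i _ ↦ ?_
    rw [map_sub, frob_frob, mul_add, mul_one]
  have h3 : ∑ i ∈ Finset.range t, frob p k (1 + n * i) (frob p k n h - h) =
      frob p k (r * s) h - frob p k 1 h := by
    have := Finset.sum_range_sub (fun i ↦ frob p k (1 + n * i) h) t
    rw [mul_zero, add_zero, ← hst] at this
    rw [← this]
    refine Finset.sum_congr rfl fun i _ ↦ ?_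
    rw [map_sub, frob_frob, mul_add, mul_one, add_assoc]
  have h4 : frob p k n (uFun p k n r m s t x y) =
      ∑ i ∈ Finset.range s, frob p k (r * i) (frob p k n y') +
        ∑ i ∈ Finset.range t, frob p k (1 + n * i) (frob p k n h) := by
    rw [uFun, map_add, map_sum, map_sum]
    congr 1 <;> exact Finset.sum_congr rfl fun i _ ↦ frob_comm _ _ _ _ _
  rw [h4, uFun]
  simp only [map_sub (frob p k _), Finset.sum_sub_distrib] at h2 h3 ⊢
  rw [hy'] at h2 ⊢
  simp only [map_sub (frob p k _), Finset.sum_sub_distrib] at h2 h3 ⊢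
  linear_combination h2 + h3

-- The terms involving `F^(n+r) x`, and then the product `F^r x * F^(2r) x`, cancel; what dominates
-- is `F^n (monom) * F^n x * F^m x`, of degree `q^(2r) + q^m` in `x`.
include hn hE in
lemma frob_wFun (hp : 0 < p) (hmr : m ≤ r) :
    frob p k n (wFun p k r m x y) = frob p k r y - frob p k r x * frob p k n x +
      frob p k n (monom p k r m x) *
        (frob p k n x * frob p k m x - x * frob p k r x - x * frob p k m x + y) := by
  have hQ := congrArg (frob p k n) (monom_mul_self p k (r := r) (m := m) (x := x) hp)
  rw [map_mul, frob_frob, show n + (r - m) = 2 * r by omega] at hQ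
  have hE' := congrArg (frob p k r) hE
  simp only [map_sub, map_mul, map_add, frob_frob] at hE'
  rw [show r + n = n + r by omega, show r + r = 2 * r by omega, ← hn] at hE'
  rw [wFun]
  simp only [map_sub, map_mul, map_add, frob_frob]
  rw [show n + (r - m) = 2 * r by omega]
  linear_combination hE' + frob p k n (monom p k r m x) * hE + frob p k r x * hQ

-- Let `Q = F^n (monom)`. The leading term `Q^q * F^(n+1) x * F^(m+1) x` of `F^n (w^q)` is cancelled
-- by the summand with `u`; this leaves `Q^q * F^n x * F^m x`, cancelled by the summand with `w`.
-- Then `-Q^q * F x * F^(r+1) x` dominates.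
include hn hE in
lemma frob_zFun (hp : 0 < p) (hmr : m ≤ r) (hst : r * s = 1 + n * t) :
    frob p k n (zFun p k n r m s t x y) =
      frob p k (r + 1) y - frob p k (r + 1) x * frob p k (n + 1) x -
        frob p k n (monom p k r m x) ^ (p ^ k - 1) *
          (frob p k r y - frob p k r x * frob p k n x) +
        frob p k n (monom p k r m x) ^ (p ^ k) *
          (-(frob p k 1 x * frob p k (r + 1) x) + frob p k 1 y + uFun p k n r m s t x y +
            x * frob p k r x - y) := by
  have hu := frob_uFun p k hn hE hst
  have hw := frob_wFun p k hn hE hp hmr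
  have hw' := congrArg (frob p k 1) hw
  have hQ := congrArg (frob p k n) (monom_pow_mul_self p k (r := r) (m := m) (x := x) hp)
  have hQ1 : frob p k 1 (frob p k n (monom p k r m x)) = frob p k n (monom p k r m x) ^ p ^ k := by
    rw [frob_apply, pow_one]
  rw [map_mul, map_pow, frob_comm p k n 1, hQ1] at hQ
  simp only [map_sub, map_mul, map_add, frob_one_frob (B := B), ← hQ1] at hw' hQ
  rw [hFun] at hu
  simp only [map_sub, map_mul, frob_one_frob (B := B)] at hu
  rw [← hQ1, zFun]
  simp only [map_sub, map_mul, map_add, map_pow, frob_comm p k n 1, frob_one_frob (B := B)] at hw' ⊢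
  linear_combination hw' + frob p k (n + 1) (monom p k r m x) * hu -
    frob p k n (monom p k r m x) ^ (p ^ k - 1) * hw -
    (frob p k n x * frob p k m x - x * frob p k r x - x * frob p k m x + y) * hQ

end Equation

end Functions

/-! ### Effect of the translations `y ↦ y + a`. -/

section Translation

variable {B : Type*} [CommRing B] (p k : ℕ) [ExpChar B p] (n r m s t : ℕ) {x y a : B}

/-- The translation of `u` induced by the translation `y ↦ y + a`. -/
noncomputable def uShift (a : B) : B := ∑ i ∈ Finset.range s, frob p k (r * i) a

lemma uFun_add : uFun p k n r m s t x (y + a) = uFun p k n r m s t x y + uShift p k r s a := by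
  have : ∀ i, frob p k (r * i) (y + a - frob p k r x * x) =
      frob p k (r * i) (y - frob p k r x * x) + frob p k (r * i) a := fun i ↦ by
    rw [← map_add]
    ring_nf
  simp only [uFun, uShift, this, Finset.sum_add_distrib]
  ring

lemma wFun_add : wFun p k r m x (y + a) =
    wFun p k r m x y + frob p k r a + a * monom p k r m x := by
  rw [wFun, wFun, map_add]
  ring

lemma zFun_add (hp : 0 < p) : zFun p k n r m s t x (y + a) - zFun p k n r m s t x y =
    frob p k (r + 1) a + frob p k 1 (monom p k r m x) * (frob p k 1 a - a + uShift p k r s a) -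
      monom p k r m x ^ (p ^ k - 1) * frob p k r a := by
  have h := monom_pow_mul_self p k (r := r) (m := m) (x := x) hp
  rw [zFun, zFun, wFun_add, uFun_add]
  simp only [map_add, map_mul, frob_one_frob (B := B)]
  linear_combination -a * h

variable {n r s t}

lemma frob_mul_of_frob_eq (ha : frob p k n a = a) (i : ℕ) : frob p k (n * i) a = a := by
  induction i with
  | zero => rw [mul_zero, frob_zero]
  | succ i ih => rw [mul_add, mul_one, ← frob_frob, ha, ih]

/-- A telescoping sum, with `F^(r s) a = F a`. The right side is the coefficient of `F (monom)` in
`zFun_add`, thus nonzero as soon as `uShift` is. -/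
lemma frob_uShift (ha : frob p k n a = a) (hst : r * s = 1 + n * t) :
    frob p k r (uShift p k r s a) = frob p k 1 a - a + uShift p k r s a := by
  have h := Finset.sum_range_sub (fun i ↦ frob p k (r * i) a) s
  rw [hst, mul_zero, frob_zero, ← frob_frob, frob_mul_of_frob_eq p k ha] at h
  rw [← h, uShift, ← Finset.sum_add_distrib, map_sum]
  refine Finset.sum_congr rfl fun i _ ↦ ?_
  rw [sub_add_cancel, frob_frob, mul_add, mul_one, add_comm]

/-- If the shift vanishes then `F a = a`, so the shift is `s a` and the trace is `n a`; combine `s a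
= n a = 0` with `r s - n t = 1`. -/
lemma eq_zero_of_uShift_eq_zero (ha : frob p k n a = a) (hst : r * s = 1 + n * t)
    (htr : ∑ i ∈ Finset.range n, frob p k i a = 0) (h0 : uShift p k r s a = 0) : a = 0 := by
  have h1 := frob_uShift p k ha hst
  rw [h0, map_zero, add_zero] at h1
  have hfix : ∀ i, frob p k i a = a := fun i ↦ by
    have := frob_mul_of_frob_eq p k (n := 1) (sub_eq_zero.1 h1.symm) i
    rwa [one_mul] at this
  simp only [uShift, hfix, Finset.sum_const, Finset.card_range, nsmul_eq_mul] at h0 htr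
  have := congrArg (Nat.cast (R := B)) hst
  push_cast at this
  linear_combination (-a) * this + (r : B) * h0 - (t : B) * htr

end Translation

section Naturality

variable {B B' : Type*} [CommRing B] [CommRing B'] (p k n r m s t : ℕ) [ExpChar B p]
  [ExpChar B' p] (f : B →+* B')

lemma map_frob (i : ℕ) (a : B) : f (frob p k i a) = frob p k i (f a) := by
  rw [frob_apply, frob_apply, map_pow]

lemma map_zFun (x y : B) :
    f (zFun p k n r m s t x y) = zFun p k n r m s t (f x) (f y) := by
  simp only [zFun, wFun, uFun, hFun, monom, map_add f, map_sub f, map_mul f, map_pow f, map_sum f,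
    map_frob p k f]

end Naturality

/-! ### Pole orders at a place where `x` has a pole. -/

section Values

variable {K L : Type*} [Field K] [Field L] [Algebra K L] (P : Place K L) (p k : ℕ) [ExpChar L p]
  {n r m s t : ℕ} {x y : L}

lemma Place.valuation_frob (i : ℕ) (a : L) : P.v (frob p k i a) = P.v a ^ (p ^ k) ^ i := by
  rw [frob_apply, map_pow]

omit [ExpChar L p] in
lemma Place.valuation_monom :
    P.v (monom p k r m x) = P.v x ^ ((p ^ k) ^ (r - m) - 1) := by
  rw [monom, map_pow]

/-- If `F^n w - w` has a pole, so does `w`, and then `F^n w` dominates. -/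
lemma Place.valuation_pow_of_frob_sub (hq : 2 ≤ p ^ k) (hn : 0 < n) {w : L}
    (hw : 1 < P.v (frob p k n w - w)) : P.v w ^ (p ^ k) ^ n = P.v (frob p k n w - w) := by
  have h1 : 1 < P.v w := by
    by_contra! h
    refine absurd hw (not_lt.2 (P.v.map_sub_le ?_ h))
    rw [P.valuation_frob]
    exact pow_le_one₀ zero_le h
  have h2 : 1 < (p ^ k) ^ n := Nat.one_lt_pow hn.ne' hq
  rw [Valuation.map_sub_eq_of_lt_left, P.valuation_frob]
  rw [P.valuation_frob]
  exact lt_self_pow₀ h1 h2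

section Bounds

variable (hq : 2 ≤ p ^ k) (hx : 1 < P.v x) (hm : 0 < m) (hmr : m < r) (hn : n = r + m)
  (hE : frob p k n y - y = (frob p k n x - x) * (frob p k r x + frob p k m x))

include hq hx in
lemma Place.valuation_frob_sub_self (hn : 0 < n) :
    P.v (frob p k n x - x) = P.v x ^ (p ^ k) ^ n := by
  rw [Valuation.map_sub_eq_of_lt_left, P.valuation_frob]
  rw [P.valuation_frob]
  exact lt_self_pow₀ hx (Nat.one_lt_pow hn.ne' hq)

include hq hx hE in
lemma Place.valuation_y_pow (hn : 0 < n)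
    (hrm : P.v (frob p k r x + frob p k m x) = P.v x ^ (p ^ k) ^ r) :
    P.v y ^ (p ^ k) ^ n = P.v x ^ ((p ^ k) ^ n + (p ^ k) ^ r) := by
  have h : P.v (frob p k n y - y) = P.v x ^ ((p ^ k) ^ n + (p ^ k) ^ r) := by
    rw [hE, map_mul, P.valuation_frob_sub_self p k hq hx hn, hrm, pow_add]
  rw [← h]
  refine P.valuation_pow_of_frob_sub p k hq hn ?_
  rw [h]
  exact one_lt_pow₀ hx (by positivity)

include hq hx in
lemma Place.valuation_frob_add_frob (hmr : m < r) :
    P.v (frob p k r x + frob p k m x) = P.v x ^ (p ^ k) ^ r := by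
  rw [Valuation.map_add_eq_of_lt_left, P.valuation_frob]
  rw [P.valuation_frob, P.valuation_frob]
  exact pow_lt_pow_right₀ hx (Nat.pow_lt_pow_right hq hmr)

lemma two_mul_pow_le {q i j : ℕ} (hq : 2 ≤ q) (hij : i < j) : 2 * q ^ i ≤ q ^ j := by
  calc 2 * q ^ i ≤ q * q ^ i := by gcongr
    _ = q ^ (i + 1) := by ring
    _ ≤ q ^ j := Nat.pow_le_pow_right (by omega) hij

-- This crude bound, like the one for `u` below, is enough to discard the terms with `y` in the
-- estimates for `w` and `z`.
include hq hx hn hE hmr in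
lemma Place.valuation_y_le : P.v y ≤ P.v x ^ 2 := by
  have h := P.valuation_y_pow p k hq hx hE (by omega) (P.valuation_frob_add_frob p k hq hx hmr)
  have hpos : (p ^ k) ^ n ≠ 0 := by positivity
  rw [← pow_le_pow_iff_left₀ zero_le zero_le hpos, h, ← pow_mul (P.v x)]
  refine pow_le_pow_right₀ hx.le ?_
  have := Nat.pow_le_pow_right (n := p ^ k) (by omega) (show r ≤ n by omega)
  omega

include hx hq hn hmr in
lemma Place.valuation_hFun : P.v (hFun p k n m x) = P.v x ^ ((p ^ k) ^ m + (p ^ k) ^ n) := by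
  rw [hFun, map_mul, P.valuation_frob_sub_self p k hq hx (by omega), P.valuation_frob, pow_add]

include hq hx hn hE hmr in
lemma Place.valuation_uFun_pow (hst : r * s = 1 + n * t) :
    P.v (uFun p k n r m s t x y) ^ (p ^ k) ^ n =
      P.v x ^ (p ^ k * ((p ^ k) ^ m + (p ^ k) ^ n)) := by
  have hn' : 0 < n := by omega
  have hlt : P.v (hFun p k n m x) < P.v (frob p k 1 (hFun p k n m x)) := by
    rw [P.valuation_frob, pow_one]
    refine lt_self_pow₀ ?_ hq
    rw [P.valuation_hFun p k hq hx hmr hn]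
    exact one_lt_pow₀ hx (by positivity)
  have h : P.v (frob p k n (uFun p k n r m s t x y) - uFun p k n r m s t x y) =
      P.v x ^ (p ^ k * ((p ^ k) ^ m + (p ^ k) ^ n)) := by
    rw [frob_uFun p k hn hE hst, Valuation.map_sub_eq_of_lt_right _ hlt, P.valuation_frob,
      P.valuation_hFun p k hq hx hmr hn, ← pow_mul, pow_one, mul_comm]
  rw [← h]
  refine P.valuation_pow_of_frob_sub p k hq hn' ?_
  rw [h]
  exact one_lt_pow₀ hx (by positivity)

include hq hx hn hE hmr in
lemma Place.valuation_uFun_le (hst : r * s = 1 + n * t) :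
    P.v (uFun p k n r m s t x y) ≤ P.v x ^ (2 * p ^ k) := by
  have h := P.valuation_uFun_pow p k hq hx hmr hn hE hst
  have hpos : (p ^ k) ^ n ≠ 0 := by positivity
  rw [← pow_le_pow_iff_left₀ zero_le zero_le hpos, h, ← pow_mul (P.v x)]
  refine pow_le_pow_right₀ hx.le ?_
  have := Nat.pow_le_pow_right (n := p ^ k) (by omega) (show m ≤ n by omega)
  nlinarith

-- `G` is the exponent of `x` in `F^n (monom)`; characterizing it by an addition avoids truncated
-- subtraction.
omit [Field K] [Algebra K L] [ExpChar L p] [Field L] in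
include hmr hn hq in
lemma monom_exponent : ∃ G, ((p ^ k) ^ (r - m) - 1) * (p ^ k) ^ n = G ∧
    G + (p ^ k) ^ n = (p ^ k) ^ (2 * r) ∧ (p ^ k) ^ n ≤ G := by
  have h1 : ((p ^ k) ^ (r - m) - 1) * (p ^ k) ^ n + (p ^ k) ^ n = (p ^ k) ^ (2 * r) := by
    have : 0 < (p ^ k) ^ (r - m) := by positivity
    rw [← Nat.succ_mul, Nat.succ_eq_add_one, Nat.sub_add_cancel this, ← pow_add]
    congr 1
    omega
  have h2 := two_mul_pow_le hq (show n < 2 * r by omega)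
  exact ⟨_, rfl, h1, by omega⟩

include hq hx hn hE hmr hm in
lemma Place.valuation_wFun_pow :
    P.v (wFun p k r m x y) ^ (p ^ k) ^ n = P.v x ^ ((p ^ k) ^ (2 * r) + (p ^ k) ^ m) := by
  have hp : 0 < p := expChar_pos L p
  obtain ⟨G, hG, hGW, hGn⟩ := monom_exponent p k hq hmr hn
  have hy := P.valuation_y_le p k hq hx hmr hn hE
  have hQ : P.v (frob p k n (monom p k r m x)) = P.v x ^ G := by
    rw [P.valuation_frob, P.valuation_monom, ← pow_mul, hG]
  have i1 := two_mul_pow_le hq hmr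
  have i2 := two_mul_pow_le hq (show r < n by omega)
  have i3 := two_mul_pow_le hq hm
  rw [pow_zero] at i3
  have hlt : ∀ {i : ℕ}, i < (p ^ k) ^ (2 * r) + (p ^ k) ^ m →
      P.v x ^ i < P.v x ^ ((p ^ k) ^ (2 * r) + (p ^ k) ^ m) := fun h ↦ pow_lt_pow_right₀ hx h
  have key : frob p k n (wFun p k r m x y) =
      frob p k n (monom p k r m x) * (frob p k n x * frob p k m x) +
      (frob p k r y - frob p k r x * frob p k n x -
        frob p k n (monom p k r m x) * (x * frob p k r x) -
        frob p k n (monom p k r m x) * (x * frob p k m x) +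
        frob p k n (monom p k r m x) * y) := by
    rw [frob_wFun p k hn hE hp hmr.le]
    ring
  have hlead : P.v (frob p k n (monom p k r m x) * (frob p k n x * frob p k m x)) =
      P.v x ^ ((p ^ k) ^ (2 * r) + (p ^ k) ^ m) := by
    rw [map_mul, map_mul, hQ, P.valuation_frob, P.valuation_frob, ← pow_add, ← pow_add, ← hGW,
      add_assoc]
  rw [← P.valuation_frob, key, Valuation.map_add_eq_of_lt_left, hlead]
  rw [hlead]
  refine P.v.map_add_lt (P.v.map_sub_lt (P.v.map_sub_lt (P.v.map_sub_lt ?_ ?_) ?_) ?_) ?_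
  · rw [P.valuation_frob]
    refine (pow_le_pow_left₀ zero_le hy _).trans_lt ?_
    rw [← pow_mul]
    exact hlt (by omega)
  · rw [map_mul, P.valuation_frob, P.valuation_frob, ← pow_add]
    exact hlt (by omega)
  · rw [map_mul, map_mul, hQ, P.valuation_frob, ← pow_succ', ← pow_add]
    exact hlt (by omega)
  · rw [map_mul, map_mul, hQ, P.valuation_frob, ← pow_succ', ← pow_add]
    exact hlt (by omega)
  · rw [map_mul, hQ]
    refine (mul_le_mul_right hy _).trans_lt ?_
    rw [← pow_add]
    exact hlt (by omega)

include hq hx hn hE hmr hm in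
lemma Place.valuation_zFun_pow (hst : r * s = 1 + n * t) :
    P.v (zFun p k n r m s t x y) ^ (p ^ k) ^ n =
      P.v x ^ (p ^ k * ((p ^ k) ^ (2 * r) - (p ^ k) ^ n + (p ^ k) ^ r + 1)) := by
  have hp : 0 < p := expChar_pos L p
  obtain ⟨G, hG, hGW, hGn⟩ := monom_exponent p k hq hmr hn
  have hy := P.valuation_y_le p k hq hx hmr hn hE
  have hu := P.valuation_uFun_le p k hq hx hmr hn hE hst
  have hQ : P.v (frob p k n (monom p k r m x)) = P.v x ^ G := by
    rw [P.valuation_frob, P.valuation_monom, ← pow_mul, hG]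
  have i1 := two_mul_pow_le hq (show 0 < r by omega)
  rw [pow_zero] at i1
  have i2 := two_mul_pow_le hq (show r < n by omega)
  rw [← hGW, Nat.add_sub_cancel]
  have key := frob_zFun p k hn hE hp hmr.le hst
  set Q := frob p k n (monom p k r m x)
  set u := uFun p k n r m s t x y
  rw [← P.valuation_frob]
  -- With `q = q' + 1` and the products `q' * G`, `q' * R`, `q' * Nn` as atoms, all comparisons of
  -- exponents become linear.
  obtain ⟨q', hq'⟩ : ∃ q', p ^ k = q' + 1 := ⟨p ^ k - 1, by omega⟩
  have j1 : (p ^ k) ^ (r + 1) = p ^ k * (p ^ k) ^ r := pow_succ' _ _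
  have j2 : (p ^ k) ^ (n + 1) = p ^ k * (p ^ k) ^ n := pow_succ' _ _
  generalize hR : (p ^ k) ^ r = R at *
  generalize hNn : (p ^ k) ^ n = Nn at *
  have key' : frob p k n (zFun p k n r m s t x y) =
      -(Q ^ (p ^ k) * (frob p k 1 x * frob p k (r + 1) x)) +
      (frob p k (r + 1) y - frob p k (r + 1) x * frob p k (n + 1) x -
        Q ^ (p ^ k - 1) * frob p k r y + Q ^ (p ^ k - 1) * (frob p k r x * frob p k n x) +
        Q ^ (p ^ k) * frob p k 1 y + Q ^ (p ^ k) * u + Q ^ (p ^ k) * (x * frob p k r x) -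
        Q ^ (p ^ k) * y) := by
    rw [key]
    ring
  have hlt : ∀ {i : ℕ}, i < p ^ k * (G + R + 1) →
      P.v x ^ i < P.v x ^ (p ^ k * (G + R + 1)) := fun h ↦ pow_lt_pow_right₀ hx h
  have hlead : P.v (-(Q ^ (p ^ k) * (frob p k 1 x * frob p k (r + 1) x))) =
      P.v x ^ (p ^ k * (G + R + 1)) := by
    rw [Valuation.map_neg, map_mul, map_mul, map_pow, hQ, P.valuation_frob, P.valuation_frob,
      ← pow_mul, ← pow_add, ← pow_add, j1]
    congr 1
    ring
  rw [key', Valuation.map_add_eq_of_lt_left, hlead]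
  rw [hlead]
  have hq1 : p ^ k - 1 = q' := by omega
  have e1 : p ^ k * (G + R + 1) = q' * G + G + q' * R + R + q' + 1 := by rw [hq']; ring
  have e2 : p ^ k * R = q' * R + R := by rw [hq']; ring
  have e3 : p ^ k * Nn = q' * Nn + Nn := by rw [hq']; ring
  have l1 : R ≤ q' * R := Nat.le_mul_of_pos_left _ (by omega)
  have l2 : q' * Nn ≤ q' * G := Nat.mul_le_mul_left _ hGn
  have l3 : q' * (2 * R) ≤ q' * Nn := Nat.mul_le_mul_left _ i2
  have l4 : q' * (2 * 1) ≤ q' * R := Nat.mul_le_mul_left _ i1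
  have l5 : q' * (2 * R) = 2 * (q' * R) := by ring
  refine P.v.map_sub_lt (P.v.map_add_lt (P.v.map_add_lt (P.v.map_add_lt (P.v.map_add_lt
    (P.v.map_sub_lt (P.v.map_sub_lt ?_ ?_) ?_) ?_) ?_) ?_) ?_) ?_
  · rw [P.valuation_frob, j1]
    refine (pow_le_pow_left₀ zero_le hy _).trans_lt ?_
    rw [← pow_mul]
    exact hlt (by omega)
  · rw [map_mul, P.valuation_frob, P.valuation_frob, ← pow_add, j1, j2]
    exact hlt (by omega)
  · rw [map_mul, map_pow, hQ, P.valuation_frob, hR, hq1, ← pow_mul]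
    refine (mul_le_mul_right (pow_le_pow_left₀ zero_le hy _) _).trans_lt ?_
    rw [← pow_mul, ← pow_add, mul_comm G]
    exact hlt (by omega)
  · rw [map_mul, map_pow, map_mul, hQ, P.valuation_frob, P.valuation_frob, hR, hNn, hq1, ← pow_mul,
      ← pow_add, ← pow_add, mul_comm G]
    exact hlt (by omega)
  · rw [map_mul, map_pow, hQ, P.valuation_frob, ← pow_mul, pow_one]
    refine (mul_le_mul_right (pow_le_pow_left₀ zero_le hy _) _).trans_lt ?_
    rw [← pow_mul, ← pow_add, mul_comm G, hq', add_mul, one_mul, ← hq']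
    exact hlt (by omega)
  · rw [map_mul, map_pow, hQ, ← pow_mul]
    refine (mul_le_mul_right hu _).trans_lt ?_
    rw [← pow_add, mul_comm G, hq', add_mul, one_mul, ← hq']
    exact hlt (by omega)
  · rw [map_mul, map_pow, map_mul, hQ, P.valuation_frob, hR, ← pow_mul, ← pow_succ', ← pow_add,
      mul_comm G, hq', add_mul, one_mul, ← hq']
    exact hlt (by omega)
  · rw [map_mul, map_pow, hQ, ← pow_mul]
    refine (mul_le_mul_right hy _).trans_lt ?_
    rw [← pow_add, mul_comm G, hq', add_mul, one_mul, ← hq']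
    exact hlt (by omega)

end Bounds

end Values

/-! ### The equation of the curve and the kernel of the trace. -/

section Curve

variable {K : Type*} [Field K] (p k : ℕ) [ExpChar K p] {n r m : ℕ}

lemma sum_frob_sub {B : Type*} [CommRing B] [ExpChar B p] (j : ℕ) (a : B) :
    frob p k 1 (∑ i ∈ Finset.range j, frob p k i a) - ∑ i ∈ Finset.range j, frob p k i a =
      frob p k j a - a := by
  have h := Finset.sum_range_sub (fun i ↦ frob p k i a) j
  rw [frob_zero] at h
  rw [← h, Finset.sum_sub_distrib, map_sum]
  simp only [frob_one_frob (B := B)]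

/-- The terms of index below `m` are already reduced. For index `m + i` the monomial is `x^(q^(m+i))
* (x^(q^n))^(q^i)`, which reduces to `x^(q^(m+i) + q^i)`; this also gives the explicit quotient
below. -/
lemma fPoly_eq (hq : 2 ≤ p ^ k) (hn : n = r + m) (hr : 0 < r) (hm : 0 < m) :
    fPoly K (p ^ k) n r = ∑ i ∈ Finset.range m, frob p k i (X * frob p k r X) +
      ∑ i ∈ Finset.range r, frob p k i (X * frob p k m X) := by
  have hexp : ∀ (i j : ℕ), frob p k i (X * frob p k j (X : K[X])) =
      X ^ ((p ^ k) ^ i + (p ^ k) ^ (i + j)) := fun i j ↦ by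
    rw [map_mul, frob_frob, frob_apply, frob_apply, ← pow_add]
  have h1n : 1 < (p ^ k) ^ n := Nat.one_lt_pow (by omega) hq
  have hmonic : (X ^ (p ^ k) ^ n - X : K[X]).Monic := monic_X_pow_sub (by
    rw [degree_X]; exact_mod_cast h1n)
  have hdeg : (X ^ (p ^ k) ^ n - X : K[X]).degree = ((p ^ k) ^ n : ℕ) := by
    rw [degree_sub_eq_left_of_degree_lt, degree_X_pow]
    rw [degree_X, degree_X_pow]
    exact_mod_cast h1n
  have hlow : ∀ i j : ℕ, 0 < j → i + j < n →
      (frob p k i (X * frob p k j (X : K[X]))).degree < (((p ^ k) ^ n : ℕ) : WithBot ℕ) := by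
    intro i j hj hij
    rw [hexp, degree_X_pow]
    have h1 := two_mul_pow_le hq hij
    have h2 := two_mul_pow_le hq (show i < i + j by omega)
    have h3 : 0 < (p ^ k) ^ i := by positivity
    exact_mod_cast (by omega : (p ^ k) ^ i + (p ^ k) ^ (i + j) < (p ^ k) ^ n)
  unfold fPoly
  rw [← modByMonic_eq_mod _ hmonic]
  refine ((div_modByMonic_unique (f := (tracePoly K (p ^ k) n).comp (X ^ (1 + (p ^ k) ^ r)))
    (∑ i ∈ Finset.range r, frob p k (m + i) X * (X ^ (p ^ k) ^ n - X) ^ ((p ^ k) ^ i - 1)) _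
    hmonic ⟨?_, ?_⟩).2)
  · have htr : (tracePoly K (p ^ k) n).comp (X ^ (1 + (p ^ k) ^ r)) =
        ∑ i ∈ Finset.range m, frob p k i (X * frob p k r X) +
          ∑ i ∈ Finset.range r, frob p k (m + i) (X * frob p k r X) := by
      rw [← Finset.sum_range_add, show m + r = n by omega, tracePoly, Polynomial.sum_comp]
      refine Finset.sum_congr rfl fun i _ ↦ ?_
      rw [hexp, X_pow_comp, ← pow_mul]
      ring_nf
    rw [htr, add_assoc, Finset.mul_sum, ← Finset.sum_add_distrib]
    congr 1
    refine Finset.sum_congr rfl fun i _ ↦ ?_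
    have h1 : (X ^ (p ^ k) ^ n - X : K[X]) * (frob p k (m + i) X *
        (X ^ (p ^ k) ^ n - X) ^ ((p ^ k) ^ i - 1)) =
        frob p k (m + i) X * frob p k i (X ^ (p ^ k) ^ n - X) := by
      have : 0 < (p ^ k) ^ i := by positivity
      rw [frob_apply p k i, mul_left_comm, ← pow_succ', Nat.sub_add_cancel this]
    rw [h1, ← frob_apply p k n X, map_sub, map_mul, map_mul, frob_frob, frob_frob, frob_frob,
      show m + i + r = i + n by omega, show i + m = m + i by omega]
    ring
  · rw [hdeg]
    refine (degree_add_le _ _).trans_lt (max_lt ?_ ?_) <;>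
      refine (degree_sum_le _ _).trans_lt ((Finset.sup_lt_iff (WithBot.bot_lt_coe _)).2 ?_)
    · intro i hi
      rw [Finset.mem_range] at hi
      exact hlow i r hr (by omega)
    · intro i hi
      rw [Finset.mem_range] at hi
      exact hlow i m hm (by omega)

/-- The equation `y ^ q ^ n - y = (x ^ q ^ n - x) (x ^ q ^ r + x ^ q ^ m)` of the curve. -/
lemma frob_sub_self_eq {L : Type*} [Field L] [Algebra K L] [ExpChar L p] (hq : 2 ≤ p ^ k)
    (hn : n = r + m) (hr : 0 < r) (hm : 0 < m) {x y : L}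
    (hxy : ∑ i ∈ Finset.range n, y ^ (p ^ k) ^ i = aeval x (fPoly K (p ^ k) n r)) :
    frob p k n y - y = (frob p k n x - x) * (frob p k r x + frob p k m x) := by
  have hf : aeval x (fPoly K (p ^ k) n r) = ∑ i ∈ Finset.range m, frob p k i (x * frob p k r x) +
      ∑ i ∈ Finset.range r, frob p k i (x * frob p k m x) := by
    have hmap := map_frob p k (aeval x : K[X] →ₐ[K] L).toRingHom
    simp only [AlgHom.toRingHom_eq_coe, RingHom.coe_coe] at hmap
    rw [fPoly_eq p k hq hn hr hm, map_add, map_sum, map_sum]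
    simp only [hmap, map_mul (aeval x : K[X] →ₐ[K] L), aeval_X]
  simp only [← frob_apply p k] at hxy
  -- Applying `F - 1` telescopes the trace of `y` and both sums in `fPoly_eq`.
  rw [← sum_frob_sub, hxy, hf, map_add, add_sub_add_comm, sum_frob_sub, sum_frob_sub, map_mul,
    map_mul, frob_frob, frob_frob, ← hn, show m + r = n by omega]
  ring

lemma frob_of_card [Finite K] (hK : Nat.card K = (p ^ k) ^ n) (a : K) : frob p k n a = a := by
  have := Fintype.ofFinite K
  rw [frob_apply, ← hK, Nat.card_eq_fintype_card, FiniteField.pow_card]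

/-- The kernel of the trace has at least `q ^ (n - 1)` elements. -/
lemma le_card_ker_trace [Finite K] (hq : 2 ≤ p ^ k) (hn : 0 < n)
    (hK : Nat.card K = (p ^ k) ^ n) :
    (p ^ k) ^ (n - 1) ≤ Nat.card {a : K // ∑ i ∈ Finset.range n, frob p k i a = 0} := by
  classical
  let T : K →+ K := ∑ i ∈ Finset.range n, (frob p k i).toAddMonoidHom
  have hT : ∀ a, T a = ∑ i ∈ Finset.range n, frob p k i a := fun a ↦ by
    simp [T]
  have h1 : Nat.card K = Nat.card (K ⧸ T.ker) * Nat.card T.ker :=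
    AddSubgroup.card_eq_card_quotient_mul_card_addSubgroup _
  -- The trace takes values among the roots of `X ^ q - X`.
  have h2 : Nat.card (K ⧸ T.ker) ≤ p ^ k := by
    rw [Nat.card_congr (QuotientAddGroup.quotientKerEquivRange T).toEquiv]
    have hne : (X ^ (p ^ k) - X : K[X]) ≠ 0 := FiniteField.X_pow_card_sub_X_ne_zero K hq
    have hsub : (T.range : Set K) ⊆ (X ^ (p ^ k) - X : K[X]).roots.toFinset := by
      rintro _ ⟨a, rfl⟩
      rw [Finset.mem_coe, Multiset.mem_toFinset, mem_roots hne, IsRoot, eval_sub, eval_pow, eval_X]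
      have h := sum_frob_sub p k n a
      rw [frob_of_card p k hK, sub_self, ← hT, frob_apply, pow_one] at h
      exact h
    calc Nat.card T.range = (T.range : Set K).ncard := rfl
      _ ≤ ((X ^ (p ^ k) - X : K[X]).roots.toFinset : Set K).ncard :=
        Set.ncard_le_ncard hsub (Finset.finite_toSet _)
      _ = (X ^ (p ^ k) - X : K[X]).roots.toFinset.card := Set.ncard_coe_finset _
      _ ≤ _ := Multiset.toFinset_card_le _
      _ ≤ _ := card_roots' _
      _ = p ^ k := FiniteField.X_pow_card_sub_X_natDegree_eq K hq
  have h3 : Nat.card T.ker = Nat.card {a : K // ∑ i ∈ Finset.range n, frob p k i a = 0} := by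
    refine Nat.card_congr (Equiv.subtypeEquivRight fun a ↦ ?_)
    rw [AddMonoidHom.mem_ker, hT]
  rw [← h3]
  have h4 : (p ^ k) * (p ^ k) ^ (n - 1) ≤ (p ^ k) * Nat.card T.ker := by
    rw [← pow_succ', Nat.sub_add_cancel hn, ← hK, h1]
    exact Nat.mul_le_mul_right _ h2
  exact Nat.le_of_mul_le_mul_left h4 (by omega)

end Curve

/-- A function whose pole order at infinity is prime to `q`. -/
noncomputable def zElt {B : Type*} [CommRing B] (p k : ℕ) [ExpChar B p] (n r m s t : ℕ)
    (x y : B) : B :=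
  -- If `m = r` then `n = 2` and `y` itself has pole order `q + 1`, prime to `q`.
  if m < r then zFun p k n r m s t x y else y

lemma map_zElt {B B' : Type*} [CommRing B] [CommRing B'] (p k n r m s t : ℕ) [ExpChar B p]
    [ExpChar B' p] (f : B →+* B') (x y : B) :
    f (zElt p k n r m s t x y) = zElt p k n r m s t (f x) (f y) := by
  unfold zElt
  split_ifs
  · exact map_zFun p k n r m s t f x y
  · rfl

section

variable {K L : Type*} [Field K] [Field L] [Algebra K L] (P : Place K L) (p k : ℕ) [ExpChar K p]
  [ExpChar L p] {n r m s t : ℕ} {x y : L}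

section Regular

variable (hx : P.v x ≤ 1) (hy : P.v y ≤ 1)

include hx in
omit [ExpChar K p] in
lemma Place.valuation_frob_le_one (i : ℕ) : P.v (frob p k i x) ≤ 1 := by
  rw [P.valuation_frob]
  exact pow_le_one₀ zero_le hx

omit [ExpChar K p] [ExpChar L p] in
include hx in
lemma Place.valuation_monom_le_one : P.v (monom p k r m x) ≤ 1 := by
  rw [P.valuation_monom]
  exact pow_le_one₀ zero_le hx

omit [ExpChar K p] in
include hx hy in
lemma Place.valuation_uFun_le_one : P.v (uFun p k n r m s t x y) ≤ 1 := by
  have hfr := fun i ↦ P.valuation_frob_le_one p k hx i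
  refine P.v.map_add_le (P.v.map_sum_le fun i _ ↦ ?_) (P.v.map_sum_le fun i _ ↦ ?_)
  · refine P.valuation_frob_le_one p k (P.v.map_sub_le hy ?_) _
    rw [map_mul]
    exact mul_le_one' (hfr _) hx
  · refine P.valuation_frob_le_one p k ?_ _
    rw [hFun, map_mul]
    exact mul_le_one' (hfr _) (P.v.map_sub_le (hfr _) hx)

omit [ExpChar K p] in
include hx hy in
lemma Place.valuation_wFun_le_one : P.v (wFun p k r m x y) ≤ 1 := by
  have hfr := fun i ↦ P.valuation_frob_le_one p k hx i
  refine P.v.map_add_le (P.v.map_sub_le (P.v.map_sub_le ?_ ?_) ?_) ?_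
  · exact P.valuation_frob_le_one p k hy r
  · rw [map_mul]
    exact mul_le_one' (hfr _) (hfr _)
  · rw [map_mul]
    exact mul_le_one' (hfr _) hx
  · rw [map_mul]
    exact mul_le_one' hy (P.valuation_monom_le_one p k hx)

omit [ExpChar K p] in
include hx hy in
lemma Place.valuation_zFun_le_one : P.v (zFun p k n r m s t x y) ≤ 1 := by
  have hM : P.v (monom p k r m x) ≤ 1 := P.valuation_monom_le_one p k hx
  have hw : P.v (wFun p k r m x y) ≤ 1 := P.valuation_wFun_le_one p k hx hy
  refine P.v.map_sub_le (P.v.map_add_le (P.valuation_frob_le_one p k hw 1) ?_) ?_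
  · rw [map_mul]
    exact mul_le_one' (P.valuation_frob_le_one p k hM 1) (P.valuation_uFun_le_one p k hx hy)
  · rw [map_mul, map_pow]
    exact mul_le_one' (pow_le_one₀ zero_le hM) hw

end Regular

variable (hq : 2 ≤ p ^ k) (hx : 1 < P.v x) (hm : 0 < m) (hmr : m ≤ r) (hn : n = r + m)
  (hmr1 : m = r → r = 1 ∧ (2 : K) ≠ 0)
  (hE : frob p k n y - y = (frob p k n x - x) * (frob p k r x + frob p k m x))

-- For `m = r` the sum is `2 x^(q^r)`, which is why `q` has to be odd when `n = 2`.
omit [ExpChar K p] in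
include hq hx hmr hmr1 in
lemma Place.valuation_frob_add_frob_of_le :
    P.v (frob p k r x + frob p k m x) = P.v x ^ (p ^ k) ^ r := by
  rcases hmr.lt_or_eq with h | h
  · exact P.valuation_frob_add_frob p k hq hx h
  · have h2 := P.trivial_on_const 2 (hmr1 h).2
    rw [map_ofNat] at h2
    rw [h, ← two_mul, map_mul, h2, one_mul, P.valuation_frob]

omit [ExpChar K p] [ExpChar L p] in
lemma Place.valuation_of_pow_eq {w : L} {c : ℕ} (hn : 0 < n) (hq : 2 ≤ p ^ k)
    (h : P.v w ^ (p ^ k) ^ n = P.v x ^ (p ^ k * c)) : P.v w ^ (p ^ k) ^ (n - 1) = P.v x ^ c := by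
  have hq0 : p ^ k ≠ 0 := by omega
  rw [← pow_left_inj₀ zero_le zero_le hq0, ← pow_mul (P.v w), ← pow_mul (P.v x),
    ← pow_succ,
    Nat.sub_add_cancel hn, h, mul_comm]

omit [ExpChar K p] in
include hq hx hm hmr hn hmr1 hE in
lemma Place.valuation_zElt_pow (hst : r * s = 1 + n * t) :
    P.v (zElt p k n r m s t x y) ^ (p ^ k) ^ (n - 1) =
      P.v x ^ ((p ^ k) ^ (2 * r) - (p ^ k) ^ n + (p ^ k) ^ r + 1) := by
  refine P.valuation_of_pow_eq p k (by omega) hq ?_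
  unfold zElt
  split_ifs with h
  · exact P.valuation_zFun_pow p k hq hx hm h hn hE hst
  · obtain rfl : m = r := le_antisymm hmr (not_lt.1 h)
    obtain ⟨rfl, h2⟩ := hmr1 rfl
    obtain rfl : n = 2 := hn
    rw [P.valuation_y_pow p k hq hx hE (by omega)
      (P.valuation_frob_add_frob_of_le p k hq hx hmr hmr1)]
    congr 1
    rw [mul_one, Nat.sub_self]
    ring

-- For `m < r` the dominant term of the difference is `F (monom)` times the constant `F^r (uShift
-- α)`, nonzero because `α ≠ 0` has trace zero. For `m = r` the difference is `α` and the exponent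
-- is `0`.
include hq hx hmr in
lemma Place.valuation_zElt_sub {α : K} (hα : α ≠ 0) (hfix : frob p k n α = α)
    (htr : ∑ i ∈ Finset.range n, frob p k i α = 0) (hst : r * s = 1 + n * t) :
    P.v (zElt p k n r m s t x (y + algebraMap K L α) - zElt p k n r m s t x y) =
      P.v x ^ (p ^ k * ((p ^ k) ^ (r - m) - 1)) := by
  have hp : 0 < p := expChar_pos L p
  unfold zElt
  split_ifs with h
  · rw [zFun_add p k n r m s t hp]
    have hmap := map_frob p k (algebraMap K L)
    have hfix' : frob p k n (algebraMap K L α) = algebraMap K L α := by rw [← hmap, hfix]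
    have hsh : uShift p k r s (algebraMap K L α) = algebraMap K L (uShift p k r s α) := by
      simp only [uShift, map_sum, hmap]
    have hne : uShift p k r s α ≠ 0 := fun h0 ↦
      hα (eq_zero_of_uShift_eq_zero p k hfix hst htr h0)
    have hv : P.v (frob p k 1 (algebraMap K L α) - algebraMap K L α +
        uShift p k r s (algebraMap K L α)) = 1 := by
      rw [← frob_uShift p k hfix' hst, hsh, P.valuation_frob, P.trivial_on_const _ hne, one_pow]
    have hα1 : ∀ i, P.v (frob p k i (algebraMap K L α)) = 1 := fun i ↦ by
      rw [P.valuation_frob, P.trivial_on_const _ hα, one_pow]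
    have hd : 1 < (p ^ k) ^ (r - m) := Nat.one_lt_pow (by omega) hq
    have hlead : P.v (frob p k 1 (monom p k r m x) * (frob p k 1 (algebraMap K L α) -
        algebraMap K L α + uShift p k r s (algebraMap K L α))) =
        P.v x ^ (p ^ k * ((p ^ k) ^ (r - m) - 1)) := by
      rw [map_mul, hv, mul_one, P.valuation_frob, P.valuation_monom, ← pow_mul, pow_one, mul_comm]
    rw [Valuation.map_sub_eq_of_lt_left, Valuation.map_add_eq_of_lt_right, hlead]
    · rw [hlead, hα1]
      exact one_lt_pow₀ hx (mul_ne_zero (by omega) (by omega))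
    · rw [Valuation.map_add_eq_of_lt_right, hlead]
      · rw [map_mul, hα1, mul_one, map_pow, P.valuation_monom, ← pow_mul]
        refine pow_lt_pow_right₀ hx ?_
        rw [mul_comm]
        exact Nat.mul_lt_mul_of_pos_right (by omega) (by omega)
      · rw [hlead, hα1]
        exact one_lt_pow₀ hx (mul_ne_zero (by omega) (by omega))
  · obtain rfl : m = r := le_antisymm hmr (not_lt.1 h)
    rw [add_sub_cancel_left, P.trivial_on_const _ hα, Nat.sub_self, pow_zero, Nat.sub_self,
      mul_zero, pow_zero]

end

/-! ### Total ramification at infinity and irreducibility. -/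

section CurvePoly

variable (K : Type*) [Field K] {q n : ℕ} (r : ℕ)

lemma exists_curvePoly_eq (hq : 2 ≤ q) (hn : 0 < n) :
    ∃ g : K[X][X], g.degree < (q ^ (n - 1) : ℕ) ∧ curvePoly K q n r = X ^ q ^ (n - 1) + g := by
  obtain ⟨n, rfl⟩ := Nat.exists_eq_succ_of_ne_zero hn.ne'
  refine ⟨∑ i ∈ Finset.range n, X ^ q ^ i - C (fPoly K q (n + 1) r), ?_, ?_⟩
  · refine (degree_sub_le _ _).trans_lt (max_lt ?_ ?_)
    · refine (degree_sum_le _ _).trans_lt ((Finset.sup_lt_iff (WithBot.bot_lt_coe _)).2 ?_)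
      intro i hi
      rw [degree_X_pow]
      exact_mod_cast Nat.pow_lt_pow_right hq (Finset.mem_range.1 hi)
    · refine degree_C_le.trans_lt ?_
      exact_mod_cast (by positivity : 0 < q ^ n)
  · rw [curvePoly, tracePoly, Finset.sum_range_succ, Nat.succ_eq_add_one, Nat.add_sub_cancel]
    ring

lemma curvePoly_monic (hq : 2 ≤ q) (hn : 0 < n) : (curvePoly K q n r).Monic := by
  obtain ⟨g, hg, h⟩ := exists_curvePoly_eq K r hq hn
  rw [h]
  exact monic_X_pow_add hg

lemma natDegree_curvePoly (hq : 2 ≤ q) (hn : 0 < n) :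
    (curvePoly K q n r).natDegree = q ^ (n - 1) := by
  obtain ⟨g, hg, h⟩ := exists_curvePoly_eq K r hq hn
  rw [h]
  refine natDegree_eq_of_degree_eq_some ?_
  rw [degree_add_eq_left_of_degree_lt, degree_X_pow]
  rwa [degree_X_pow]

lemma derivative_curvePoly (hq : (q : K) = 0) (hn : 0 < n) :
    derivative (curvePoly K q n r) = 1 := by
  have hq' : (q : K[X]) = 0 := by
    rw [← map_natCast (C : K →+* K[X]), hq, map_zero]
  obtain ⟨n, rfl⟩ := Nat.exists_eq_succ_of_ne_zero hn.ne'
  rw [curvePoly, tracePoly, derivative_sub, derivative_C, sub_zero, derivative_sum,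
    Finset.sum_range_succ', Finset.sum_eq_zero, zero_add, pow_zero, pow_one, derivative_X]
  intro i _
  rw [derivative_X_pow, pow_succ, Nat.cast_mul, hq', mul_zero, map_zero, zero_mul]

end CurvePoly

section Generic

open WithZero

variable {K L : Type*} [Field K] [Field L] [Algebra K L] [Algebra (RatFunc K) L]
  [IsScalarTower K (RatFunc K) L]

/-- The equation of the curve over `K(x)`. -/
noncomputable abbrev curveRat (K : Type*) [Field K] (q n r : ℕ) : (RatFunc K)[X] :=
  (curvePoly K q n r).map (algebraMap K[X] (RatFunc K))

lemma aeval_curveRat (q n r : ℕ) (y : L) : aeval y (curveRat K q n r) =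
    ∑ i ∈ Finset.range n, y ^ q ^ i - aeval (ratX K L) (fPoly K q n r) := by
  rw [curveRat, curvePoly, tracePoly, Polynomial.map_sub, Polynomial.map_sum, map_sub, map_sum,
    map_C, aeval_C]
  congr 1
  · simp
  · rw [ratX, aeval_algebraMap_apply]
    congr 1
    rw [← RatFunc.algebraMap_X, aeval_algebraMap_apply, aeval_X_left_apply]

lemma separable_curveRat {q n r : ℕ} (hq : (q : K) = 0) (hn : 0 < n) :
    (curveRat K q n r).Separable := by
  rw [Polynomial.Separable, curveRat, derivative_map, derivative_curvePoly K r hq hn,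
    Polynomial.map_one]
  exact isCoprime_one_right

/-- A function whose pole orders have the right ratio to those of `x` forces total ramification
at infinity. -/
lemma Place.totallyRamified [FiniteDimensional (RatFunc K) L] {N b : ℕ} (hN : 0 < N)
    (hfin : Module.finrank (RatFunc K) L ≤ N) (hb : Nat.Coprime N b) (P : Place K L)
    (hx : 1 < P.v (ratX K L)) {z : L} (hz : P.v z ^ N = P.v (ratX K L) ^ b) :
    P.v (ratX K L) = exp (N : ℤ) ∧ P.v z = exp (b : ℤ) ∧ Module.finrank (RatFunc K) L = N := by
  have hx0 : P.v (ratX K L) ≠ 0 := ne_zero_of_lt hx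
  have hz0 : P.v z ≠ 0 := by
    intro h
    rw [h, zero_pow hN.ne'] at hz
    exact pow_ne_zero b hx0 hz.symm
  obtain ⟨a, ha⟩ : ∃ a, P.v (ratX K L) = exp a := ⟨_, (exp_log hx0).symm⟩
  obtain ⟨d, hd⟩ : ∃ d, P.v z = exp d := ⟨_, (exp_log hz0).symm⟩
  have ha0 : 0 < a := by rwa [ha, ← exp_zero, exp_lt_exp] at hx
  lift a to ℕ using ha0.le
  have ha0' : 0 < a := by exact_mod_cast ha0
  rw [ha, hd, ← exp_nsmul, ← exp_nsmul, exp_inj, nsmul_eq_mul, nsmul_eq_mul] at hz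
  -- From `N d = b a` with `b` prime to `N`; then `N ≤ a ≤ [L : K(X)] ≤ N`.
  have hdvd : (N : ℤ) ∣ a :=
    (Nat.isCoprime_iff_coprime.2 hb).dvd_of_dvd_mul_left ⟨d, hz.symm⟩
  have hNa : N ≤ a := Nat.le_of_dvd ha0' (Int.natCast_dvd_natCast.1 hdvd)
  have haf := P.le_finrank ha0' ha
  obtain rfl : a = N := by omega
  refine ⟨ha, ?_, by omega⟩
  rw [hd, exp_inj]
  apply mul_left_cancel₀ ha0.ne'
  rw [hz, mul_comm]

end Generic

section Data

variable (K : Type*) [Field K] (p k n r m s t : ℕ)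

/-- The standing hypotheses on the parameters, with `q = p ^ k`, `m = n - r` and
`r s = 1 + n t`. -/
structure Params : Prop where
  two_le : 2 ≤ p ^ k
  m_pos : 0 < m
  m_le : m ≤ r
  n_eq : n = r + m
  eq_one : m = r → r = 1 ∧ (2 : K) ≠ 0
  bezout : r * s = 1 + n * t
  cast_eq_zero : ((p ^ k : ℕ) : K) = 0

end Data

section Field

open WithZero

variable {K L : Type*} [Field K] [Field L] [Algebra K L] [Algebra (RatFunc K) L]
  [IsScalarTower K (RatFunc K) L] {p k n r m s t : ℕ} [ExpChar K p] [ExpChar L p]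
  (H : Params K p k n r m s t) {y : L} (hy : aeval y (curveRat K (p ^ k) n r) = 0)
  (htop : IntermediateField.adjoin (RatFunc K) {y} = ⊤)

namespace Params

include H

omit [ExpChar K p] in
lemma n_pos : 0 < n := by have := H.m_pos; have := H.n_eq; omega

omit [ExpChar K p] in
lemma N_pos : 0 < (p ^ k) ^ (n - 1) := by have := H.two_le; positivity

omit [ExpChar K p] in
lemma coprime : Nat.Coprime ((p ^ k) ^ (n - 1))
    ((p ^ k) ^ (2 * r) - (p ^ k) ^ n + (p ^ k) ^ r + 1) := by
  have h0 := H.m_pos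
  have h1 := H.m_le
  have h2 := H.n_eq
  obtain ⟨c, hc⟩ : p ^ k ∣ (p ^ k) ^ (2 * r) - (p ^ k) ^ n + (p ^ k) ^ r :=
    dvd_add (Nat.dvd_sub (dvd_pow_self _ (by omega)) (dvd_pow_self _ (by omega)))
      (dvd_pow_self _ (by omega))
  rw [hc]
  exact coprime_pow_mul_add_one _ _ _

omit [Algebra K L] [IsScalarTower K (RatFunc K) L] [ExpChar K p] [ExpChar L p] in
include hy in
lemma isIntegral : IsIntegral (RatFunc K) y :=
  ⟨curveRat K (p ^ k) n r, (curvePoly_monic K r H.two_le H.n_pos).map _, hy⟩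

include hy in
lemma equation : frob p k n y - y = (frob p k n (ratX K L) - ratX K L) *
    (frob p k r (ratX K L) + frob p k m (ratX K L)) := by
  rw [aeval_curveRat, sub_eq_zero] at hy
  have := H.m_le
  have := H.m_pos
  exact frob_sub_self_eq p k H.two_le H.n_eq (by omega) H.m_pos hy

omit [Algebra K L] [IsScalarTower K (RatFunc K) L] [ExpChar K p] [ExpChar L p] in
include hy htop in
lemma finiteDimensional : FiniteDimensional (RatFunc K) L := by
  have := IntermediateField.adjoin.finiteDimensional (H.isIntegral hy)
  rw [htop] at this
  exact Module.Finite.equiv (IntermediateField.topEquiv (F := RatFunc K) (E := L)).toLinearEquiv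

omit [Algebra K L] [IsScalarTower K (RatFunc K) L] [ExpChar K p] [ExpChar L p] in
include hy htop in
lemma isSeparable : Algebra.IsSeparable (RatFunc K) L := by
  have hsep : IsSeparable (RatFunc K) y :=
    (separable_curveRat H.cast_eq_zero H.n_pos).of_dvd (minpoly.dvd _ _ hy)
  have := (IntermediateField.isSeparable_adjoin_simple_iff_isSeparable (RatFunc K) L).2 hsep
  rw [htop] at this
  exact AlgEquiv.Algebra.isSeparable (IntermediateField.topEquiv (F := RatFunc K) (E := L))

omit [Algebra K L] [IsScalarTower K (RatFunc K) L] [ExpChar K p] [ExpChar L p] in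
include hy htop in
lemma finrank_eq : Module.finrank (RatFunc K) L = (minpoly (RatFunc K) y).natDegree := by
  rw [← IntermediateField.adjoin.finrank (H.isIntegral hy), htop, IntermediateField.finrank_top']

omit [Algebra K L] [IsScalarTower K (RatFunc K) L] [ExpChar K p] [ExpChar L p] in
include hy htop in
lemma finrank_le : Module.finrank (RatFunc K) L ≤ (p ^ k) ^ (n - 1) := by
  have hmon := (curvePoly_monic K r H.two_le H.n_pos).map (algebraMap K[X] (RatFunc K))
  rw [H.finrank_eq hy htop, ← natDegree_curvePoly K r H.two_le H.n_pos,
    ← (curvePoly_monic K r H.two_le H.n_pos).natDegree_map (algebraMap K[X] (RatFunc K))]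
  exact natDegree_le_of_dvd (minpoly.dvd _ _ hy) hmon.ne_zero

include hy htop in
lemma totallyRamified (P : Place K L) (hx : 1 < P.v (ratX K L)) :
    P.v (ratX K L) = exp (((p ^ k) ^ (n - 1) : ℕ) : ℤ) ∧
      P.v (zElt p k n r m s t (ratX K L) y) =
        exp (((p ^ k) ^ (2 * r) - (p ^ k) ^ n + (p ^ k) ^ r + 1 : ℕ) : ℤ) ∧
      Module.finrank (RatFunc K) L = (p ^ k) ^ (n - 1) := by
  have := H.finiteDimensional hy htop
  exact P.totallyRamified H.N_pos (H.finrank_le hy htop) H.coprime hx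
    (P.valuation_zElt_pow p k H.two_le hx H.m_pos H.m_le H.n_eq H.eq_one (H.equation hy) H.bezout)

include hy htop in
/-- There is exactly one place at infinity. -/
lemma existsUnique_place : ∃! P : Place K L, 1 < P.v (ratX K L) := by
  have := H.finiteDimensional hy htop
  have := H.isSeparable hy htop
  obtain ⟨P, hP⟩ := exists_place_one_lt K L
  refine ⟨P, hP, fun Q hQ ↦ ?_⟩
  obtain ⟨h1, h2, h3⟩ := H.totallyRamified hy htop P hP
  obtain ⟨h4, h5, -⟩ := H.totallyRamified hy htop Q hQ
  exact Q.eq_of_valuation_eq H.N_pos H.coprime P h4 h5 h1 h2 h3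

include hy htop in
lemma finrank : Module.finrank (RatFunc K) L = (p ^ k) ^ (n - 1) := by
  obtain ⟨P, hP, -⟩ := H.existsUnique_place hy htop
  exact (H.totallyRamified hy htop P hP).2.2

end Params

end Field

section Irreducible

variable {K : Type*} [Field K] {p k n r m s t : ℕ} [ExpChar K p] (H : Params K p k n r m s t)

-- Adjoining a root of any irreducible factor `g` over `K(x)` gives a field to which total
-- ramification applies, so `g` has degree `N` and is the whole polynomial up to a unit. Gauss's
-- lemma descends irreducibility to `K[x][y]`.
include H in
lemma Params.isDomain : IsDomain (CoordinateRing K (p ^ k) n r) := by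
  have hmon := curvePoly_monic K r H.two_le H.n_pos
  have hmon' := hmon.map (algebraMap K[X] (RatFunc K))
  have hdeg : (curveRat K (p ^ k) n r).natDegree = (p ^ k) ^ (n - 1) :=
    (hmon.natDegree_map _).trans (natDegree_curvePoly K r H.two_le H.n_pos)
  have hN := H.N_pos
  have hnu : ¬ IsUnit (curveRat K (p ^ k) n r) := fun h ↦ by
    have := natDegree_eq_zero_of_isUnit h
    omega
  obtain ⟨g, hg, hgdvd⟩ := WfDvdMonoid.exists_irreducible_factor hnu hmon'.ne_zero
  have : Fact (Irreducible g) := ⟨hg⟩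
  let L := AdjoinRoot g
  have : ExpChar L p := expChar_of_injective_algebraMap (algebraMap K L).injective p
  have hroot : aeval (AdjoinRoot.root g) (curveRat K (p ^ k) n r) = 0 := by
    obtain ⟨c, hc⟩ := hgdvd
    rw [hc, map_mul, AdjoinRoot.aeval_eq, AdjoinRoot.mk_self, zero_mul]
  have htop : IntermediateField.adjoin (RatFunc K) {AdjoinRoot.root g} = ⊤ := by
    rw [← IntermediateField.adjoin_eq_top_of_algebra]
    exact AdjoinRoot.adjoinRoot_eq_top
  have hfin := H.finrank (L := L) hroot htop
  have hfin' : Module.finrank (RatFunc K) L = g.natDegree :=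
    (AdjoinRoot.powerBasis hg.ne_zero).finrank.trans (AdjoinRoot.powerBasis_dim hg.ne_zero)
  have hirr : Irreducible (curveRat K (p ^ k) n r) := by
    have hass : Associated g (curveRat K (p ^ k) n r) :=
      associated_of_dvd_of_natDegree_le hgdvd hmon'.ne_zero (by omega)
    exact hass.irreducible hg
  have hirr' : Irreducible (curvePoly K (p ^ k) n r) :=
    (hmon.irreducible_iff_irreducible_map_fraction_map (K := RatFunc K)).2 hirr
  exact AdjoinRoot.isDomain_of_prime hirr'.prime

end Irreducible

/-! ### The different of `z` and the largest gap. -/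

section Different

open WithZero

variable {K L : Type*} [Field K] [Finite K] [Field L] [Algebra K L] [Algebra (RatFunc K) L]
  [IsScalarTower K (RatFunc K) L] {p k n r m s t : ℕ} [ExpChar K p] [ExpChar L p]
  (H : Params K p k n r m s t) {y : L} (hy : aeval y (curveRat K (p ^ k) n r) = 0)
  (htop : IntermediateField.adjoin (RatFunc K) {y} = ⊤)

namespace Params

include H hy htop

omit [Finite K] in
/-- The automorphism `y ↦ y + α` for `α` of trace zero. -/
lemma exists_translation {α : K} (hα : ∑ i ∈ Finset.range n, frob p k i α = 0) :
    ∃ f : L →ₐ[RatFunc K] L, f y = y + algebraMap K L α := by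
  have hintegral := H.isIntegral hy
  have hmin : minpoly (RatFunc K) y = curveRat K (p ^ k) n r := by
    have hmon := (curvePoly_monic K r H.two_le H.n_pos).map (algebraMap K[X] (RatFunc K))
    refine (eq_of_monic_of_dvd_of_natDegree_le (minpoly.monic hintegral) hmon
      (minpoly.dvd _ _ hy) ?_).symm
    rw [← H.finrank_eq hy htop, H.finrank hy htop,
      (curvePoly_monic K r H.two_le H.n_pos).natDegree_map,
      natDegree_curvePoly K r H.two_le H.n_pos]
  let pb : PowerBasis (RatFunc K) L := (IntermediateField.adjoin.powerBasis hintegral).map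
    ((IntermediateField.equivOfEq htop).trans IntermediateField.topEquiv)
  have hgen : pb.gen = y := by simp [pb]
  have hroot : aeval (y + algebraMap K L α) (minpoly (RatFunc K) pb.gen) = 0 := by
    have hmap := map_frob p k (algebraMap K L)
    rw [aeval_curveRat] at hy
    rw [hgen, hmin, aeval_curveRat]
    simp only [← frob_apply p k, map_add, Finset.sum_add_distrib, ← hmap] at hy ⊢
    rw [← map_sum, hα, map_zero, add_zero, hy]
  refine ⟨pb.lift _ hroot, ?_⟩
  have := pb.lift_gen _ hroot
  rwa [hgen] at this

/-- The value of the different at infinity. -/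
lemma valuation_derivative_minpoly (hK : Nat.card K = (p ^ k) ^ n) (P : Place K L)
    (hx : 1 < P.v (ratX K L)) :
    P.v (aeval (zElt p k n r m s t (ratX K L) y)
      (derivative (minpoly (RatFunc K) (zElt p k n r m s t (ratX K L) y)))) =
    exp ((((p ^ k) ^ (n - 1) - 1) * ((p ^ k) ^ (2 * r) - (p ^ k) ^ n) : ℕ) : ℤ) := by
  classical
  have := H.finiteDimensional hy htop
  obtain ⟨hvx, hvz, hfin⟩ := H.totallyRamified hy htop P hx
  have := Fintype.ofFinite K
  let V : Finset K := Finset.univ.filter fun α ↦ ∑ i ∈ Finset.range n, frob p k i α = 0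
  let z : K → L := fun α ↦ zElt p k n r m s t (ratX K L) (y + algebraMap K L α)
  have hz0 : zElt p k n r m s t (ratX K L) y = z 0 := by simp [z]
  have hdiff : ∀ α ∈ V, ∀ β ∈ V, α ≠ β → P.v (z α - z β) =
      exp (((p ^ k) ^ (2 * r) - (p ^ k) ^ n : ℕ) : ℤ) := by
    intro α hα β hβ hne
    simp only [V, Finset.mem_filter, Finset.mem_univ, true_and] at hα hβ
    have h := P.valuation_zElt_sub p k H.two_le hx H.m_le (n := n) (s := s) (t := t)
      (y := y + algebraMap K L β) (sub_ne_zero.2 hne) (frob_of_card p k hK _)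
      (by simp only [map_sub, Finset.sum_sub_distrib, hα, hβ, sub_zero]) H.bezout
    rw [map_sub (algebraMap K L), add_assoc, add_sub_cancel] at h
    rw [h, hvx, ← exp_nsmul, exp_inj, nsmul_eq_mul, ← Nat.cast_mul, Nat.cast_inj, mul_right_comm,
      ← pow_succ', Nat.sub_add_cancel H.n_pos, Nat.mul_sub, mul_one, ← pow_add]
    congr 2
    have := H.n_eq
    have := H.m_le
    omega
  have hinj : Set.InjOn z V := by
    intro α hα β hβ h
    by_contra hne
    have := hdiff α hα β hβ hne
    rw [h, sub_self, map_zero] at this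
    exact exp_ne_zero this.symm
  have hVcard : (p ^ k) ^ (n - 1) ≤ V.card := by
    have := le_card_ker_trace p k H.two_le H.n_pos hK
    rwa [Nat.card_eq_fintype_card, Fintype.card_subtype] at this
  set M := minpoly (RatFunc K) (zElt p k n r m s t (ratX K L) y) with hM
  have hintegral : IsIntegral (RatFunc K) (zElt p k n r m s t (ratX K L) y) :=
    Algebra.IsIntegral.isIntegral _
  have hMmon : (M.map (algebraMap (RatFunc K) L)).Monic := (minpoly.monic hintegral).map _
  have hMdeg : (M.map (algebraMap (RatFunc K) L)).natDegree = (p ^ k) ^ (n - 1) := by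
    rw [natDegree_map]
    exact P.natDegree_minpoly H.N_pos H.coprime hvx hvz hfin
  have hroots : ∀ α ∈ V, (M.map (algebraMap (RatFunc K) L)).IsRoot (z α) := by
    intro α hα
    simp only [V, Finset.mem_filter, Finset.mem_univ, true_and] at hα
    obtain ⟨f, hf⟩ := H.exists_translation hy htop hα
    have h1 : f (zElt p k n r m s t (ratX K L) y) = z α := by
      have := map_zElt p k n r m s t f.toRingHom (ratX K L) y
      simp only [AlgHom.toRingHom_eq_coe, RingHom.coe_coe] at this
      rw [this, hf, ratX, f.commutes]
    rw [IsRoot, eval_map_algebraMap, ← h1, aeval_algHom_apply, minpoly.aeval, map_zero]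
  -- The `z α` are distinct roots of `M`, and there are at least `N = deg M` of them, so `M` is
  -- their nodal polynomial and its derivative at `z 0` is the product of the differences.
  have hdvd : Lagrange.nodal V z ∣ M.map (algebraMap (RatFunc K) L) := by
    rw [Lagrange.nodal]
    refine Finset.prod_dvd_of_coprime (fun α hα β hβ hne ↦ ?_) fun α hα ↦
      dvd_iff_isRoot.2 (hroots α hα)
    exact isCoprime_X_sub_C_of_isUnit_sub
      (IsUnit.mk0 _ (sub_ne_zero.2 fun h ↦ hne (hinj hα hβ h)))
  have hnod : M.map (algebraMap (RatFunc K) L) = Lagrange.nodal V z :=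
    eq_of_monic_of_dvd_of_natDegree_le (Lagrange.nodal_monic) hMmon hdvd (by
      rw [hMdeg, Lagrange.natDegree_nodal]; exact hVcard)
  have hV : V.card = (p ^ k) ^ (n - 1) := by
    rw [← hMdeg, hnod, Lagrange.natDegree_nodal]
  have h0V : (0 : K) ∈ V := by simp [V]
  rw [← eval_map_algebraMap, ← derivative_map, hnod, hz0,
    Lagrange.eval_nodal_derivative_eval_node_eq h0V, Lagrange.eval_nodal, map_prod,
    Finset.prod_congr rfl fun α hα ↦ hdiff 0 h0V α (Finset.mem_of_mem_erase hα)
      (Finset.ne_of_mem_erase hα).symm, Finset.prod_const, Finset.card_erase_of_mem h0V, hV,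
    ← exp_nsmul, nsmul_eq_mul, Nat.cast_mul]

/-- The largest gap. -/
lemma valuation_ne [Algebra K[X] L] [IsScalarTower K[X] (RatFunc K) L] [IsScalarTower K K[X] L]
    (hK : Nat.card K = (p ^ k) ^ n) (P : Place K L) (hx : 1 < P.v (ratX K L)) {f : L}
    (hf : ∀ Q : Place K L, Q ≠ P → Q.v f ≤ 1) :
    P.v f ≠ exp ((p ^ k : ℤ) ^ (n + r - 1) - (p ^ k) ^ r - 1) := by
  intro hvf
  have := H.finiteDimensional hy htop
  have := H.isSeparable hy htop
  obtain ⟨hvx, hvz, hfin⟩ := H.totallyRamified hy htop P hx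
  have hintegral : IsIntegral K[X] f := isIntegral_of_forall_place fun Q hQ ↦ hf Q (by
    rintro rfl
    exact absurd hx (not_lt.2 hQ))
  have hge := zero_le_intDegree_trace hintegral
  have hlt := (P.valuation_trace H.N_pos H.coprime hvx hvz hfin
    (H.valuation_derivative_minpoly hy htop hK P hx) (f := f) (by
      -- Here `(N - 1) b - δ - N = (N - 1)(q^r + 1) - N`, since `δ = (N - 1)(q^(2r) - q^n)`.
      rw [hvf, exp_inj]
      have h1 : 1 ≤ (p ^ k) ^ (n - 1) := H.N_pos
      have h2 : (p ^ k) ^ n ≤ (p ^ k) ^ (2 * r) := by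
        have := H.n_eq
        have := H.m_le
        exact Nat.pow_le_pow_right (by have := H.two_le; omega) (by omega)
      have h3 : n + r - 1 = (n - 1) + r := by have := H.n_pos; omega
      push_cast [Nat.cast_sub h1, Nat.cast_sub h2]
      rw [h3]
      ring)).2
  omega

end Params

end Different

/-! ### Pole orders and the Weierstrass semigroup of a place. -/

namespace Place

open WithZero

variable {K F : Type*} [Field K] [Field F] [Algebra K F] (P : Place K F)

lemma poleOrder_eq (f : F) : P.poleOrder f = (log (P.v f)).toNat := by
  rw [poleOrder, ord, neg_neg]

lemma poleOrder_eq_zero_iff {f : F} (hf : f ≠ 0) : P.poleOrder f = 0 ↔ P.v f ≤ 1 := by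
  have h : P.v f ≠ 0 := (Valuation.ne_zero_iff _).2 hf
  rw [poleOrder_eq, Int.toNat_eq_zero, log_le_iff_le_exp h, exp_zero]

/-- Positivity of `a` is needed: `poleOrder` is `0` at zeros as well as at units. -/
lemma poleOrder_eq_iff {f : F} {a : ℕ} (ha : 0 < a) :
    P.poleOrder f = a ↔ P.v f = exp (a : ℤ) := by
  rw [poleOrder_eq]
  constructor
  · intro h
    have h0 : P.v f ≠ 0 := by
      intro h0
      rw [h0, log_zero] at h
      simp only [Int.toNat_zero] at h
      omega
    rw [← exp_log h0, exp_inj]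
    omega
  · intro h
    rw [h, log_exp, Int.toNat_natCast]

lemma mem_weierstrassSemigroup {f : F} {a : ℕ} (hf : P.v f = exp (a : ℤ))
    (hreg : ∀ Q : Place K F, Q ≠ P → Q.v f ≤ 1) : a ∈ P.weierstrassSemigroup := by
  have hf0 : f ≠ 0 := by
    rw [← Valuation.ne_zero_iff P.v, hf]
    exact exp_ne_zero
  exact ⟨f, hf0, by rw [poleOrder_eq, hf, log_exp, Int.toNat_natCast],
    fun Q hQ ↦ (Q.poleOrder_eq_zero_iff hf0).2 (hreg Q hQ)⟩

lemma exists_of_mem_weierstrassSemigroup {a : ℕ} (ha : 0 < a) (h : a ∈ P.weierstrassSemigroup) :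
    ∃ f : F, P.v f = exp (a : ℤ) ∧ ∀ Q : Place K F, Q ≠ P → Q.v f ≤ 1 := by
  obtain ⟨f, hf0, hf, hQ⟩ := h
  exact ⟨f, (P.poleOrder_eq_iff ha).1 hf, fun Q hQP ↦ (Q.poleOrder_eq_zero_iff hf0).1 (hQ Q hQP)⟩

lemma zero_mem_weierstrassSemigroup : 0 ∈ P.weierstrassSemigroup :=
  P.mem_weierstrassSemigroup (f := 1) (by simp) (fun Q _ ↦ by simp)

lemma add_mem_weierstrassSemigroup {a b : ℕ} (ha : a ∈ P.weierstrassSemigroup)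
    (hb : b ∈ P.weierstrassSemigroup) : a + b ∈ P.weierstrassSemigroup := by
  rcases Nat.eq_zero_or_pos a with rfl | ha0
  · rwa [zero_add]
  rcases Nat.eq_zero_or_pos b with rfl | hb0
  · rwa [add_zero]
  obtain ⟨f, hf, hfQ⟩ := P.exists_of_mem_weierstrassSemigroup ha0 ha
  obtain ⟨g, hg, hgQ⟩ := P.exists_of_mem_weierstrassSemigroup hb0 hb
  refine P.mem_weierstrassSemigroup (f := f * g) ?_ fun Q hQ ↦ ?_
  · rw [map_mul, hf, hg, ← exp_add, Nat.cast_add]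
  · rw [map_mul]
    exact mul_le_one' (hfQ Q hQ) (hgQ Q hQ)

lemma closure_subset_weierstrassSemigroup {T : Set ℕ} (hT : T ⊆ P.weierstrassSemigroup) :
    (AddSubmonoid.closure T : Set ℕ) ⊆ P.weierstrassSemigroup := by
  intro a ha
  induction ha using AddSubmonoid.closure_induction with
  | mem a ha => exact hT ha
  | zero => exact P.zero_mem_weierstrassSemigroup
  | add a b _ _ iha ihb => exact P.add_mem_weierstrassSemigroup iha ihb

end Place

/-! ### The semigroup at infinity. -/

section Semigroup

open WithZero

variable {K L : Type*} [Field K] [Field L] [Algebra K L] [Algebra (RatFunc K) L]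
  [IsScalarTower K (RatFunc K) L] {p k n r m s t : ℕ} [ExpChar K p] [ExpChar L p]
  (H : Params K p k n r m s t) {y : L} (hy : aeval y (curveRat K (p ^ k) n r) = 0)
  (htop : IntermediateField.adjoin (RatFunc K) {y} = ⊤)

namespace Params

include H hy

lemma valuation_y_le_one (Q : Place K L) (hQ : Q.v (ratX K L) ≤ 1) : Q.v y ≤ 1 := by
  by_contra! h
  have hE := H.equation hy
  have h1 : 1 < (p ^ k) ^ n := Nat.one_lt_pow H.n_pos.ne' H.two_le
  have h2 : Q.v (frob p k n y - y) = Q.v y ^ (p ^ k) ^ n := by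
    rw [Valuation.map_sub_eq_of_lt_left, Q.valuation_frob]
    rw [Q.valuation_frob]
    exact lt_self_pow₀ h h1
  have hfr := fun i ↦ Q.valuation_frob_le_one p k hQ i
  have h3 : Q.v (frob p k n y - y) ≤ 1 := by
    rw [hE, map_mul]
    exact mul_le_one' (Q.v.map_sub_le (hfr _) hQ) (Q.v.map_add_le (hfr _) (hfr _))
  rw [h2] at h3
  exact absurd (one_lt_pow₀ h (by omega : (p ^ k) ^ n ≠ 0)) (not_lt.2 h3)

lemma valuation_y_pow (P : Place K L) (hx : 1 < P.v (ratX K L)) :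
    P.v y ^ (p ^ k) ^ n = P.v (ratX K L) ^ ((p ^ k) ^ n + (p ^ k) ^ r) :=
  P.valuation_y_pow p k H.two_le hx (H.equation hy) H.n_pos
    (P.valuation_frob_add_frob_of_le p k H.two_le hx H.m_le H.eq_one)

/-- `y` is regular wherever `x` is, and where `x` has a pole `y` has a larger one. -/
lemma valuation_lt_iff (P : Place K L) :
    (P.v (ratX K L) < P.v y ∧ 1 < P.v y) ↔ 1 < P.v (ratX K L) := by
  constructor
  · rintro ⟨-, h⟩
    by_contra! hx
    exact absurd h (not_lt.2 (H.valuation_y_le_one hy P hx))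
  · intro hx
    have hlt : P.v (ratX K L) < P.v y := by
      have h0 : (p ^ k) ^ n ≠ 0 := by have := H.two_le; positivity
      rw [← pow_lt_pow_iff_left₀ zero_le zero_le h0, H.valuation_y_pow hy P hx]
      refine pow_lt_pow_right₀ hx ?_
      have := H.two_le
      have : 0 < (p ^ k) ^ r := by positivity
      omega
    exact ⟨hlt, hx.trans hlt⟩

include htop

lemma valuation_eq_exp (P : Place K L) (hx : 1 < P.v (ratX K L)) {w : L} {c : ℕ}
    (hw : P.v w ^ (p ^ k) ^ n = P.v (ratX K L) ^ (p ^ k * c)) : P.v w = exp (c : ℤ) := by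
  have hN : (p ^ k) ^ (n - 1) ≠ 0 := H.N_pos.ne'
  have h := P.valuation_of_pow_eq p k H.n_pos H.two_le hw
  rw [(H.totallyRamified hy htop P hx).1, ← exp_nsmul] at h
  rw [← pow_left_inj₀ zero_le zero_le hN, h, ← exp_nsmul, nsmul_eq_mul, nsmul_eq_mul, mul_comm]

section Generators

variable (P : Place K L) (hx : 1 < P.v (ratX K L))
  (hP : ∀ Q : Place K L, Q ≠ P → Q.v (ratX K L) ≤ 1)

include hx hP

lemma mem_semigroup_x : (p ^ k) ^ (n - 1) ∈ P.weierstrassSemigroup :=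
  P.mem_weierstrassSemigroup (H.totallyRamified hy htop P hx).1 hP

lemma mem_semigroup_y :
    (p ^ k) ^ (n - 1) + (p ^ k) ^ (r - 1) ∈ P.weierstrassSemigroup := by
  refine P.mem_weierstrassSemigroup (f := y) (H.valuation_eq_exp hy htop P hx ?_)
    fun Q hQ ↦ H.valuation_y_le_one hy Q (hP Q hQ)
  have h0 := H.m_pos
  have h1 := H.m_le
  have h2 := H.n_pos
  rw [H.valuation_y_pow hy P hx, mul_add, ← pow_succ', ← pow_succ', Nat.sub_add_cancel h2,
    Nat.sub_add_cancel (by omega)]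

lemma mem_semigroup_u (hmr : m < r) :
    (p ^ k) ^ n + (p ^ k) ^ m ∈ P.weierstrassSemigroup := by
  refine P.mem_weierstrassSemigroup (f := uFun p k n r m s t (ratX K L) y)
    (H.valuation_eq_exp hy htop P hx ?_)
    fun Q hQ ↦ Q.valuation_uFun_le_one p k (hP Q hQ) (H.valuation_y_le_one hy Q (hP Q hQ))
  rw [P.valuation_uFun_pow p k H.two_le hx hmr H.n_eq (H.equation hy) H.bezout,
    add_comm ((p ^ k) ^ n)]

lemma mem_semigroup_w (hmr : m < r) :
    (p ^ k) ^ (2 * r - 1) + (p ^ k) ^ (m - 1) ∈ P.weierstrassSemigroup := by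
  refine P.mem_weierstrassSemigroup (f := wFun p k r m (ratX K L) y)
    (H.valuation_eq_exp hy htop P hx ?_)
    fun Q hQ ↦ Q.valuation_wFun_le_one p k (hP Q hQ) (H.valuation_y_le_one hy Q (hP Q hQ))
  have h0 := H.m_pos
  rw [P.valuation_wFun_pow p k H.two_le hx H.m_pos hmr H.n_eq (H.equation hy), mul_add,
    ← pow_succ', ← pow_succ', Nat.sub_add_cancel h0, Nat.sub_add_cancel (by omega)]

lemma mem_semigroup_z (hmr : m < r) :
    (p ^ k) ^ (2 * r) - (p ^ k) ^ n + (p ^ k) ^ r + 1 ∈ P.weierstrassSemigroup :=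
  P.mem_weierstrassSemigroup (f := zFun p k n r m s t (ratX K L) y)
    (H.valuation_eq_exp hy htop P hx
      (P.valuation_zFun_pow p k H.two_le hx H.m_pos hmr H.n_eq (H.equation hy) H.bezout))
    fun Q hQ ↦ Q.valuation_zFun_le_one p k (hP Q hQ) (H.valuation_y_le_one hy Q (hP Q hQ))

variable [Finite K] [Algebra K[X] L] [IsScalarTower K[X] (RatFunc K) L] [IsScalarTower K K[X] L]
  (hK : Nat.card K = (p ^ k) ^ n)

include hK

omit hP in
lemma notMem_semigroup {l : ℕ}
    (hl : (l : ℤ) = (p ^ k : ℤ) ^ (n + r - 1) - (p ^ k) ^ r - 1) (hl0 : 0 < l) :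
    l ∉ P.weierstrassSemigroup := by
  intro h
  obtain ⟨f, hf, hfQ⟩ := P.exists_of_mem_weierstrassSemigroup hl0 h
  exact H.valuation_ne hy htop hK P hx hfQ (by rw [hf, hl])

/-- The Weierstrass semigroup at infinity. -/
lemma weierstrassSemigroup_eq :
    P.weierstrassSemigroup = (AddSubmonoid.closure
      {(p ^ k) ^ (n - 1), (p ^ k) ^ (n - 1) + (p ^ k) ^ (r - 1), (p ^ k) ^ n + (p ^ k) ^ (n - r),
        (p ^ k) ^ (2 * r - 1) + (p ^ k) ^ (n - r - 1),
        (p ^ k) ^ (2 * r) - (p ^ k) ^ n + (p ^ k) ^ r + 1} : Set ℕ) ∧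
    IsTelescopic P.weierstrassSemigroup ∧ IsSymmetric P.weierstrassSemigroup := by
  have h0 := H.m_pos
  have hnrm := H.n_eq
  have hq := H.two_le
  have hq1 : 1 ≤ p ^ k := by omega
  obtain ⟨l, hl, hl0⟩ : ∃ l : ℕ, (l : ℤ) = (p ^ k : ℤ) ^ (n + r - 1) - (p ^ k) ^ r - 1 ∧ 0 < l := by
    have hr := H.m_le
    have h1 := two_mul_pow_le hq (show r < n + r - 1 by omega)
    have h2 := two_mul_pow_le hq (show 0 < r by omega)
    rw [pow_zero] at h2
    refine ⟨(p ^ k) ^ (n + r - 1) - (p ^ k) ^ r - 1, ?_, by omega⟩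
    rw [Nat.cast_sub (by omega), Nat.cast_sub (by omega)]
    push_cast
    ring
  have hlH := H.notMem_semigroup hy htop P hx hK hl hl0
  have hadd : ∀ a ∈ P.weierstrassSemigroup, ∀ b ∈ P.weierstrassSemigroup,
      a + b ∈ P.weierstrassSemigroup := fun a ha b hb ↦ P.add_mem_weierstrassSemigroup ha hb
  have hsx := H.mem_semigroup_x hy htop P hx hP
  have hsy := H.mem_semigroup_y hy htop P hx hP
  rcases H.m_le.lt_or_eq with hmr | hmr
  · obtain ⟨μ, rfl⟩ : ∃ μ, m = μ + 1 := ⟨m - 1, by omega⟩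
    obtain ⟨σ, rfl⟩ : ∃ σ, r = μ + σ + 2 := ⟨r - μ - 2, by omega⟩
    obtain rfl : n = 2 * μ + σ + 3 := by omega
    have hsu := H.mem_semigroup_u hy htop P hx hP hmr
    have hsw := H.mem_semigroup_w hy htop P hx hP hmr
    have hsz := H.mem_semigroup_z hy htop P hx hP hmr
    rw [show 2 * (μ + σ + 2) - 1 = 2 * μ + 2 * σ + 3 by omega, Nat.add_sub_cancel] at hsw
    rw [show 2 * (μ + σ + 2) = 2 * μ + 2 * σ + 4 by omega] at hsz
    rw [show 2 * μ + σ + 3 - 1 = 2 * μ + σ + 2 by omega] at hsx hsy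
    rw [show μ + σ + 2 - 1 = μ + σ + 1 by omega] at hsy
    have hS := isSymmetricAbout_gens μ σ hq1
    rw [show (((p ^ k : ℕ) : ℤ) ^ (3 * μ + 2 * σ + 4) - ((p ^ k : ℕ) : ℤ) ^ (μ + σ + 2) - 1 : ℤ) =
      (l : ℤ) by
        rw [hl, show 2 * μ + σ + 3 + (μ + σ + 2) - 1 = 3 * μ + 2 * σ + 4 by omega]
        push_cast
        ring] at hS
    have hsub : (AddSubmonoid.closure (Set.range (gens (p ^ k) μ σ)) : Set ℕ) ⊆
        P.weierstrassSemigroup := by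
      refine P.closure_subset_weierstrassSemigroup ?_
      rw [range_gens]
      rintro z (rfl | rfl | rfl | rfl | rfl) <;> assumption
    have heq := hS.eq_of_le hsub hadd hlH
    refine ⟨?_, ?_, ?_⟩
    · rw [heq, range_gens, show 2 * μ + σ + 3 - 1 = 2 * μ + σ + 2 by omega,
        show μ + σ + 2 - 1 = μ + σ + 1 by omega,
        show 2 * μ + σ + 3 - (μ + σ + 2) = μ + 1 by omega,
        show 2 * (μ + σ + 2) - 1 = 2 * μ + 2 * σ + 3 by omega, Nat.add_sub_cancel,
        show 2 * (μ + σ + 2) = 2 * μ + 2 * σ + 4 by omega]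
    · exact ⟨5, gens (p ^ k) μ σ, isTelescopicSeq_gens μ σ hq1, heq⟩
    · rw [heq]
      exact hS.isSymmetric
  · obtain ⟨rfl, -⟩ := H.eq_one hmr
    obtain rfl := hmr
    obtain rfl : n = 2 := by omega
    have hS := isSymmetricAbout_self_succ hq1
    rw [show (((p ^ k : ℕ) : ℤ) ^ 2 - (p ^ k : ℕ) - 1 : ℤ) = (l : ℤ) by
      rw [hl]; push_cast; ring] at hS
    simp only [Nat.add_one_sub_one, pow_one, Nat.sub_self, pow_zero] at hsx hsy
    have hsub : (AddSubmonoid.closure {p ^ k, p ^ k + 1} : Set ℕ) ⊆ P.weierstrassSemigroup := by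
      refine P.closure_subset_weierstrassSemigroup ?_
      rintro z (rfl | rfl) <;> assumption
    have heq := hS.eq_of_le hsub hadd hlH
    refine ⟨?_, ?_, ?_⟩
    · rw [heq]
      simp only [Nat.add_one_sub_one, pow_one, Nat.sub_self, pow_zero, mul_one, zero_add]
      congr 1
      -- The third generator is now `q^2 + q = q (q + 1)`, and the last two equal `q + 1`.
      refine le_antisymm (AddSubmonoid.closure_mono ?_) ((AddSubmonoid.closure_le).2 ?_)
      · rintro z (rfl | rfl) <;> simp
      · have h1 : p ^ k ∈ AddSubmonoid.closure {p ^ k, p ^ k + 1} :=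
          AddSubmonoid.subset_closure (by simp)
        have h2 : p ^ k + 1 ∈ AddSubmonoid.closure {p ^ k, p ^ k + 1} :=
          AddSubmonoid.subset_closure (by simp)
        rintro z (rfl | rfl | rfl | rfl | rfl)
        · exact h1
        · exact h2
        · have := nsmul_mem h2 (p ^ k)
          rw [smul_eq_mul] at this
          rw [SetLike.mem_coe]
          convert this using 1
          ring
        · exact h2
        · exact h2
    · refine ⟨2, ![p ^ k, p ^ k + 1], isTelescopicSeq_self_succ hq1, ?_⟩
      rw [heq]
      congr 2
      simp [Matrix.range_cons, Set.pair_comm]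
    · rw [heq]
      exact hS.isSymmetric

end Generators

end Params

end Semigroup

/-! ### The function field as an extension of `K(x)`, and the parameters. -/

section FunctionField

variable (K : Type*) [Field K] {q n : ℕ} (r : ℕ)

lemma injective_algebraMap_functionField (hq : 2 ≤ q) (hn : 0 < n) :
    Function.Injective (algebraMap K[X] (FunctionField K q n r)) := by
  rw [IsScalarTower.algebraMap_eq K[X] (CoordinateRing K q n r) (FunctionField K q n r),
    RingHom.coe_comp]
  refine (IsFractionRing.injective _ _).comp ((injective_iff_map_eq_zero _).2 fun g hg ↦ ?_)
  rw [AdjoinRoot.algebraMap_eq, ← AdjoinRoot.mk_C, AdjoinRoot.mk_eq_zero] at hg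
  by_contra hg0
  refine (curvePoly_monic K r hq hn).not_dvd_of_natDegree_lt (C_ne_zero.2 hg0) ?_ hg
  rw [natDegree_C, natDegree_curvePoly K r hq hn]
  positivity

variable {r} [IsDomain (CoordinateRing K q n r)] [Algebra (RatFunc K) (FunctionField K q n r)]
  [IsScalarTower K[X] (RatFunc K) (FunctionField K q n r)]

lemma ratX_eq_xFun : ratX K (FunctionField K q n r) = xFun K q n r := by
  rw [ratX, ← RatFunc.algebraMap_X,
    ← IsScalarTower.algebraMap_apply K[X] (RatFunc K) (FunctionField K q n r),
    IsScalarTower.algebraMap_apply K[X] (CoordinateRing K q n r) (FunctionField K q n r),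
    AdjoinRoot.algebraMap_eq, xFun]

omit [IsDomain (CoordinateRing K q n r)] in
lemma aeval_yFun_curveRat : aeval (yFun K q n r) (curveRat K q n r) = 0 := by
  rw [curveRat, aeval_map_algebraMap, yFun, aeval_algebraMap_apply, AdjoinRoot.aeval_eq,
    AdjoinRoot.mk_self, map_zero]

lemma adjoin_yFun : IntermediateField.adjoin (RatFunc K) {yFun K q n r} = ⊤ := by
  have hmem (a : CoordinateRing K q n r) : algebraMap _ (FunctionField K q n r) a ∈
      IntermediateField.adjoin (RatFunc K) {yFun K q n r} := by
    obtain ⟨g, rfl⟩ := AdjoinRoot.mk_surjective a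
    rw [← AdjoinRoot.aeval_eq, ← aeval_algebraMap_apply,
      ← aeval_map_algebraMap (RatFunc K)]
    exact IntermediateField.algebra_adjoin_le_adjoin _ _
      (aeval_mem_adjoin_singleton (RatFunc K) (yFun K q n r))
  refine eq_top_iff.2 fun z _ ↦ ?_
  obtain ⟨a, b, -, rfl⟩ := IsFractionRing.div_surjective (A := CoordinateRing K q n r) z
  exact div_mem (hmem a) (hmem b)

end FunctionField

section Params

variable {K : Type*} [Field K] {p k n r : ℕ}

lemma exists_params [CharP K p] (hp : p.Prime) (hk : 0 < k) (hn : 2 ≤ n) (hr : n ≤ 2 * r)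
    (hrn : r ≤ n - 1) (hnr : Nat.gcd n r = 1) (hodd : n = 2 → Odd (p ^ k)) :
    ∃ s t, Params K p k n r (n - r) s t := by
  -- `s` inverts `r` modulo `n`, and `t` is the quotient of `r s` by `n`.
  obtain ⟨s, -, hs⟩ := Nat.exists_mul_mod_eq_one_of_coprime (Nat.Coprime.symm hnr) (by omega)
  refine ⟨s, r * s / n, ?_, by omega, by omega, by omega, fun h ↦ ?_, ?_, ?_⟩
  · exact hp.two_le.trans (Nat.le_self_pow hk.ne' p)
  · obtain rfl : r = 1 := by
      rw [show n = 2 * r by omega, Nat.gcd_mul_left_left] at hnr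
      exact hnr
    refine ⟨rfl, fun h2 ↦ ?_⟩
    have h2' : p ∣ 2 := (CharP.cast_eq_zero_iff K p 2).1 (by exact_mod_cast h2)
    obtain rfl : p = 2 := (Nat.prime_dvd_prime_iff_eq hp Nat.prime_two).1 h2'
    have := hodd (by omega)
    rw [Nat.odd_pow_iff hk.ne'] at this
    exact absurd this (by decide)
  · have := Nat.mod_add_div (r * s) n
    rw [hs] at this
    exact this.symm
  · rw [Nat.cast_pow, CharP.cast_eq_zero, zero_pow hk.ne']

end Params

end Xnr

theorem mainTheorem1 (K : Type*) [Field K] [Finite K] (q n r : ℕ) (hq : IsPrimePow q)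
    (hK : Nat.card K = q ^ n) (hn : 2 ≤ n) (hr : n ≤ 2 * r) (hrn : r ≤ n - 1)
    (hnr : Nat.gcd n r = 1) (hodd : n = 2 → Odd q) :
    ∃ _ : IsDomain (Xnr.CoordinateRing K q n r),
      ∃ P : Xnr.Place K (Xnr.FunctionField K q n r),
        (∀ Q : Xnr.Place K (Xnr.FunctionField K q n r),
          Xnr.LiesOverInfty K q n r Q ↔ Q = P) ∧
        P.weierstrassSemigroup =
          (AddSubmonoid.closure
            ({q ^ (n - 1), q ^ (n - 1) + q ^ (r - 1), q ^ n + q ^ (n - r),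
              q ^ (2 * r - 1) + q ^ (n - r - 1), q ^ (2 * r) - q ^ n + q ^ r + 1} : Set ℕ) :
            Set ℕ) ∧
        Xnr.IsTelescopic P.weierstrassSemigroup ∧
        Xnr.IsSymmetric P.weierstrassSemigroup := by
  obtain ⟨p, k, hp, hk, rfl⟩ := (isPrimePow_nat_iff _).1 hq
  have : Fact p.Prime := ⟨hp⟩
  have := Fintype.ofFinite K
  have : CharP K p := charP_of_card_eq_prime_pow (f := k * n) (by
    rw [← Nat.card_eq_fintype_card, hK, pow_mul])
  have : ExpChar K p := ExpChar.prime hp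
  obtain ⟨s, t, H⟩ := Xnr.exists_params (K := K) hp hk hn hr hrn hnr hodd
  have hdom : IsDomain (Xnr.CoordinateRing K (p ^ k) n r) := H.isDomain
  refine ⟨hdom, ?_⟩
  let F := Xnr.FunctionField K (p ^ k) n r
  have hinj : Function.Injective (algebraMap K[X] F) :=
    Xnr.injective_algebraMap_functionField K r H.two_le H.n_pos
  -- `K(X)` acts through `X ↦ x`, which puts `F` in the setting of an extension of `K(X)` generated
  -- by a root of the curve equation.
  let : Algebra (RatFunc K) F := (IsFractionRing.lift hinj).toAlgebra
  have : IsScalarTower K[X] (RatFunc K) F :=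
    .of_algebraMap_eq fun g ↦ (IsFractionRing.lift_algebraMap hinj g).symm
  have : IsScalarTower K (RatFunc K) F := .of_algebraMap_eq fun a ↦ by
    rw [IsScalarTower.algebraMap_apply K K[X] (RatFunc K),
      ← IsScalarTower.algebraMap_apply K[X] (RatFunc K) F,
      ← IsScalarTower.algebraMap_apply K K[X] F]
  have : ExpChar F p := expChar_of_injective_algebraMap (algebraMap K F).injective p
  have hy := Xnr.aeval_yFun_curveRat K (q := p ^ k) (n := n) (r := r)
  have htop := Xnr.adjoin_yFun K (q := p ^ k) (n := n) (r := r)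
  obtain ⟨P, hx, huniq⟩ := H.existsUnique_place hy htop
  have hP (Q : Xnr.Place K F) (hQ : Q ≠ P) : Q.v (Xnr.ratX K F) ≤ 1 :=
    not_lt.1 fun h ↦ hQ (huniq Q h)
  refine ⟨P, fun Q ↦ ?_, H.weierstrassSemigroup_eq hy htop P hx hP hK⟩
  rw [Xnr.LiesOverInfty, ← Xnr.ratX_eq_xFun, H.valuation_lt_iff hy Q]
  exact ⟨huniq Q, fun h ↦ h ▸ hx⟩
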